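/- Let $(X_1,X_2,X_3)$ be any standard basis of $\mathfrak{su}(2)$, i.e. $[X_1,X_2]=X_3$, $[X_2,X_3]=X_1$, $[X_3,X_1]=X_2$, and let $\bar g$ be the left-invariant metric on $SU(2)$ for which it is orthonormal. Identify left-invariant metrics with positive definite symmetric $3\times3$ matrices $g$ via this basis, so that $\bar g=I$, and write $g_{a_1,a_2,a_3}=\mathrm{diag}(a_1,a_2,a_3)$. A unit left-invariant universal spinor field is $\Phi=[A,\varphi]$ with $A\in GL_+(3)$ (more precisely a lift of it to the double cover), $g=A^{-T}A^{-1}$, and $\varphi\in\mathbb C^2$ a unit vector, viewed as a spinor field that is constant in the $g$-orthonormal left-invariant frame $Y_i=AX_i$. Its spinorial energy is $\mathcal E(\Phi)=\frac12\int|\nabla^g\varphi|^2\,\mathrm{vol}_g$, where the volume of $\bar g$ is normalized to $1$, and $Q=(Q_1,Q_2)$ is the negative $L^2$-gradient of $\mathcal E$ on unit left-invariant universal spinor fields, split into metric and spinor directions by the Bourguignon–Gauduchon connection (whose horizontal vectors are the $\dot A$ with $A^{-1}\dot A$ symmetric). The volume-normalized homogeneous spinor flow is $\dot g=\tilde Q_1=Q_1+\frac16\,\frac{\mathcal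 E}{\mathrm{vol}(g)}\,g$, $\dot\varphi=Q_2$, written along the horizontal lift $A_t$ of $g_t$. Then: (a) $\bar g$ is round (it has constant positive sectional curvature), and every unit left-invariant spinor field is a Killing spinor for $\bar g$ with a non-zero real Killing number. (b) For $g=g_{a_1,a_2,a_3}$ with $a_i>0$ and any unit $\varphi$, $\tilde Q_1$ is diagonal, $\tilde Q_1=\mathrm{diag}(V(a_1,a_2,a_3))$, independent of $\varphi$ and of the chosen $A$, and $Q_2=0$. Moreover $V(1,1,1)=0$, and the linearization of $\dot a=V(a)$ at $(1,1,1)$ is $$\dot\alpha=-\frac{5}{48}\begin{pmatrix}2&-1&-1\\-1&2&-1\\-1&-1&2\end{pmatrix}\alpha .$$ The eigenvalues of this coefficient matrix are exactly $0$, with eigenspace spanned by the scaling direction $(1,1,1)$, and $-\frac5{16}$, with the two-dimensional eigenspace $\{\alpha_1+\alpha_2+\alpha_3=0\}$. (c) There is $R>0$ such that for every left-invariant metric $g$ (not necessarily diagonal) with $\det g=1$, i.e. of the same volume as $\bar g$, and with Euclidean distance less than $R$ from $\bar g$, and for every unit left-invariant universal spinor field $[A_0,\varphi_0]$ over $g$,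 the volume-normalized homogeneous spinor flow with initial value $[A_0,\varphi_0]$ exists for all $t\ge0$, is unique, has $\varphi_t=\varphi_0$ for all $t$, and satisfies $g_t\to\bar g$ as $t\to\infty$. (d) $\bar g$ is Lyapunov stable among left-invariant metrics of its volume: for every $\varepsilon>0$ there is $\delta>0$ such that every solution on $[0,\infty)$ whose initial metric has the volume of $\bar g$ and distance less than $\delta$ from $\bar g$ keeps distance less than $\varepsilon$ from $\bar g$ for all $t\ge0$. -/

import Mathlib

open Matrix Filter Topology

attribute [local instance] LieRing.ofAssociativeRing LieAlgebra.ofAssociativeAlgebra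

noncomputable section

namespace SpinorFlow

/-- The real Lie algebra of the group `SU(2)`: traceless skew-Hermitian complex `2 × 2` matrices
with the commutator bracket. -/
def su2 : LieSubalgebra ℝ (Matrix (Fin 2) (Fin 2) ℂ) where
  carrier := {M | Mᴴ = -M ∧ M.trace = 0}
  add_mem' := by
    rintro M N ⟨hM, hM'⟩ ⟨hN, hN'⟩
    refine ⟨?_, by rw [trace_add, hM', hN', add_zero]⟩
    rw [conjTranspose_add, hM, hN, neg_add]
  zero_mem' := by simp
  smul_mem' := by
    rintro c M ⟨hM, hM'⟩
    refine ⟨?_, by rw [trace_smul, hM', smul_zero]⟩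
    rw [conjTranspose_smul, hM, star_trivial, smul_neg]
  lie_mem' := by
    rintro M N ⟨hM, -⟩ ⟨hN, -⟩
    refine ⟨?_, ?_⟩
    · rw [Ring.lie_def, conjTranspose_sub, conjTranspose_mul, conjTranspose_mul, hM, hN]
      simp
    · rw [Ring.lie_def, trace_sub, trace_mul_comm, sub_self]

/-- Matrices of endomorphisms and of bilinear forms on the three-dimensional Lie algebra, with
respect to a fixed basis `X`. -/
abbrev Mat3 := Matrix (Fin 3) (Fin 3) ℝ

/-- The complex spinor module in dimension three, with its Hermitian inner product. -/
abbrev Spinor := EuclideanSpace ℂ (Fin 2)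

/-- The unit vectors `E₁, E₂, E₃` of the Clifford algebra, `E_j E_k + E_k E_j = -2 δ_{jk}`, as
matrices on `ℂ²` (`√-1` times the Pauli matrices). -/
def cliffordGen : Fin 3 → Matrix (Fin 2) (Fin 2) ℂ :=
  ![!![0, Complex.I; Complex.I, 0], !![0, 1; -1, 0], !![Complex.I, 0; 0, -Complex.I]]

/-- Clifford multiplication by the `j`-th vector of the orthonormal frame. -/
def clif (j : Fin 3) (φ : Spinor) : Spinor := WithLp.toLp 2 (cliffordGen j *ᵥ φ.ofLp)

section LieAlgebra

variable {𝔤 : Type*} [LieRing 𝔤] [LieAlgebra ℝ 𝔤]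

/-- A standard basis of `𝔰𝔲(2)`: `[X₁,X₂] = X₃`, `[X₂,X₃] = X₁`, `[X₃,X₁] = X₂`. -/
def IsStandardBasis (X : Module.Basis (Fin 3) ℝ 𝔤) : Prop :=
  ⁅X 0, X 1⁆ = X 2 ∧ ⁅X 1, X 2⁆ = X 0 ∧ ⁅X 2, X 0⁆ = X 1

/-- The matrix `A⁻ᵀ A⁻¹` of the left-invariant metric `g^A = ḡ(A⁻¹ ·, A⁻¹ ·)`, where `ḡ` is the
left-invariant metric for which the basis `X` is orthonormal. -/
def metricOf (A : Mat3) : Mat3 := (A⁻¹)ᵀ * A⁻¹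

/-- The metric `g^A` as a bilinear form on the Lie algebra. -/
def metricForm (X : Module.Basis (Fin 3) ℝ 𝔤) (A : Mat3) (U V : 𝔤) : ℝ :=
  X.repr U ⬝ᵥ (metricOf A *ᵥ X.repr V)

/-- The `g^A`-orthonormal frame `Y_i = A X_i`. -/
def frame (X : Module.Basis (Fin 3) ℝ 𝔤) (A : Mat3) (i : Fin 3) : 𝔤 := ∑ j, A j i • X j

/-- `g(∇_U V, W)` for the Levi-Civita connection `∇` of the left-invariant metric `g = g^A` and
left-invariant vector fields `U, V, W` (Koszul formula; the derivative terms vanish). -/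
def koszul (X : Module.Basis (Fin 3) ℝ 𝔤) (A : Mat3) (U V W : 𝔤) : ℝ :=
  (1 / 2) * (metricForm X A ⁅U, V⁆ W - metricForm X A ⁅V, W⁆ U + metricForm X A ⁅W, U⁆ V)

/-- The left-invariant vector field `∇_U V`, expanded in the orthonormal frame. -/
def leviCivita (X : Module.Basis (Fin 3) ℝ 𝔤) (A : Mat3) (U V : 𝔤) : 𝔤 :=
  ∑ k, koszul X A U V (frame X A k) • frame X A k

/-- The Riemann curvature tensor on left-invariant vector fields. -/
def curvature (X : Module.Basis (Fin 3) ℝ 𝔤) (A : Mat3) (U V W : 𝔤) : 𝔤 :=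
  leviCivita X A U (leviCivita X A V W) - leviCivita X A V (leviCivita X A U W)
    - leviCivita X A ⁅U, V⁆ W

/-- The metric `g^A` is round: it has constant positive sectional curvature `κ`. -/
def IsRound (X : Module.Basis (Fin 3) ℝ 𝔤) (A : Mat3) : Prop :=
  ∃ κ : ℝ, 0 < κ ∧ ∀ U V W : 𝔤,
    curvature X A U V W = κ • (metricForm X A V W • U - metricForm X A U W • V)

/-- The spinorial Levi-Civita derivative `∇_U φ = ¼ ∑_{j,k} g(∇_U Y_j, Y_k) E_j · E_k · φ` of the
left-invariant spinor field with constant value `φ` in the left-invariant frame `Y`. -/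
def spinDeriv (X : Module.Basis (Fin 3) ℝ 𝔤) (A : Mat3) (φ : Spinor) (U : 𝔤) : Spinor :=
  (1 / 4 : ℝ) • ∑ j, ∑ k, koszul X A U (frame X A j) (frame X A k) • clif j (clif k φ)

/-- Clifford multiplication `U · φ` for the metric `g^A`. -/
def cliffordMul (X : Module.Basis (Fin 3) ℝ 𝔤) (A : Mat3) (U : 𝔤) (φ : Spinor) : Spinor :=
  ∑ i, metricForm X A U (frame X A i) • clif i φ

/-- The left-invariant spinor field `φ` is a Killing spinor for `g^A` (with a non-zero real
Killing number `μ`). -/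
def IsKillingSpinor (X : Module.Basis (Fin 3) ℝ 𝔤) (A : Mat3) (φ : Spinor) : Prop :=
  φ ≠ 0 ∧ ∃ μ : ℝ, μ ≠ 0 ∧ ∀ U : 𝔤, spinDeriv X A φ U = μ • cliffordMul X A U φ

/-- The volume of `g^A`, in units of the volume of the background metric `ḡ`. -/
def vol (A : Mat3) : ℝ := 1 / A.det

/-- The spinorial energy `½ ∫ |∇^g φ|² vol_g` of the left-invariant universal spinor field
`Φ = [A, φ]`. The integrand is left-invariant, hence constant. -/
def energy (X : Module.Basis (Fin 3) ℝ 𝔤) (A : Mat3) (φ : Spinor) : ℝ :=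
  (1 / 2) * (∑ i, ‖spinDeriv X A φ (frame X A i)‖ ^ 2) * vol A

/-- The `L²`-inner product at `g^A` of two left-invariant symmetric 2-tensors. -/
def tensorInner (A h k : Mat3) : ℝ :=
  (h * (metricOf A)⁻¹ * k * (metricOf A)⁻¹).trace * vol A

/-- The (real) `L²`-inner product at `g^A` of two left-invariant spinor fields. -/
def spinorInner (A : Mat3) (φ ψ : Spinor) : ℝ := (inner ℂ φ ψ).re * vol A

/-- `M` is a horizontal tangent vector at `A` for the Bourguignon-Gauduchon connection on
`GL₊(3) → GL₊(3)/SO(3)`, i.e. `A⁻¹ M` is symmetric. -/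
def IsHorizontal (A M : Mat3) : Prop := (A⁻¹ * M).IsSymm

/-- The derivative of the metric `g^A = A⁻ᵀ A⁻¹` in the direction of `M` at `A`. -/
def metricVariation (A M : Mat3) : Mat3 :=
  -((metricOf A * M * A⁻¹)ᵀ + metricOf A * M * A⁻¹)

/-- `(q₁, q₂)`, with `q₁` a symmetric tensor and `q₂` a spinor orthogonal to `φ`, is the negative
gradient `Q(Φ) = (Q₁(Φ), Q₂(Φ))` of the spinorial energy at `Φ = [A, φ]`, with respect to the
`L²`-metric and the splitting into metric and spinorial directions: the derivative of the energy
along a horizontal variation of `Φ` over a variation `ġ` of the metric is `-((q₁, ġ))_g`, and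
the one along a variation `ψ ⊥ φ` of the spinor is `-⟪q₂, ψ⟫`. -/
def IsNegGradient (X : Module.Basis (Fin 3) ℝ 𝔤) (A : Mat3) (φ : Spinor)
    (q₁ : Mat3) (q₂ : Spinor) : Prop :=
  q₁.IsSymm ∧
  (∀ M : Mat3, IsHorizontal A M →
    HasDerivAt (fun s : ℝ => energy X (A + s • M) φ)
      (-tensorInner A q₁ (metricVariation A M)) 0) ∧
  (inner ℂ φ q₂).re = 0 ∧
  (∀ ψ : Spinor, (inner ℂ φ ψ).re = 0 →
    HasDerivAt (fun s : ℝ => energy X A (φ + s • ψ)) (-spinorInner A q₂ ψ) 0)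

/-- `(q₁, q₂)` is the right-hand side `(Q̃₁, Q̃₂)` of the volume-normalized spinor flow at
`Φ = [A, φ]` in dimension `n = 3`: `Q̃₁ = Q₁ + (n-2)/(2n) · (ℰ(Φ)/vol g) g` and `Q̃₂ = Q₂`. -/
def IsNormalizedVelocity (X : Module.Basis (Fin 3) ℝ 𝔤) (A : Mat3) (φ : Spinor)
    (q₁ : Mat3) (q₂ : Spinor) : Prop :=
  IsNegGradient X A φ (q₁ - ((1 / 6) * (energy X A φ / vol A)) • metricOf A) q₂

/-- The curve `t ↦ [A_t, φ_t]`, `t ∈ I`, of unit left-invariant universal spinor fields, written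
with `A_t` the horizontal lift of the curve `g_t = A_t⁻ᵀ A_t⁻¹` of metrics, is a solution of the
volume-normalized homogeneous spinor flow. -/
def IsNormalizedFlow (X : Module.Basis (Fin 3) ℝ 𝔤) (I : Set ℝ) (A : ℝ → Mat3)
    (φ : ℝ → Spinor) : Prop :=
  ∀ t ∈ I, 0 < (A t).det ∧ ‖φ t‖ = 1 ∧
    (∃ A' : Mat3, HasDerivWithinAt A A' I t ∧ IsHorizontal (A t) A') ∧
    ∃ q₁ q₂, IsNormalizedVelocity X (A t) (φ t) q₁ q₂ ∧
      HasDerivWithinAt (fun s => metricOf (A s)) q₁ I t ∧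
      HasDerivWithinAt φ q₂ I t

end LieAlgebra

/-- The Euclidean distance of two symmetric matrices. -/
def matDist (g h : Mat3) : ℝ := √(∑ i, ∑ j, (g i j - h i j) ^ 2)

/-- The coefficient matrix of the linearized flow on diagonal metrics. -/
def linMatrix : Mat3 := (-(5 / 48) : ℝ) • !![2, -1, -1; -1, 2, -1; -1, -1, 2]

end SpinorFlow

end

open SpinorFlow

/-! In dimension three the spin derivative of a constant spinor is Clifford multiplication by a real
vector, an isometry up to scale. The energy therefore sees `φ` only through its norm, and
`energy_eq` gives `(1/8) ‖φ‖² det A · F(g)` with `g = A⁻ᵀA⁻¹` and `F(g) = tr g² - ¼ (tr g)²`. Hence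
`Q₂ = 0`, and differentiating `F` gives `Q̃₁ = -⅛ (det A)² g P(g)` for a polynomial `P` with `tr
P(g) = 0`, so the determinant is conserved.

Horizontality together with the velocity of `g` determines the velocity of `A`. On `det A = 1` the
flow becomes the polynomial ODE `C' = -(1/16) C P(CᵀC)` for the coframe `C = A⁻¹`, with `g = CᵀC`.

Convergence does not go through the linearization. The function `tr g` is a global Lyapunov
function: positivity of `g` yields `tr (g P(g)) ≥ 0`, and for `det g = 1` even `tr (g P(g)) ≥
(3/5)(tr g - 3)`, while AM-GM gives `tr g ≥ 3`. So trajectories stay bounded and exist for all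
positive time, `tr g - 3` decays exponentially, and `matDist_sq_le` turns this into convergence and
Lyapunov stability. The linearization and its spectrum are a separate computation on diagonal
metrics. -/

namespace SpinorFlow

/-! ### Derivatives of matrix-valued curves. -/

section MatrixCalculus

variable {A B : ℝ → Mat3} {A' B' : Mat3} {s : Set ℝ} {t : ℝ}

theorem hasDerivWithinAt_matrix_iff :
    HasDerivWithinAt A A' s t ↔ ∀ i j, HasDerivWithinAt (fun x => A x i j) (A' i j) s t := by
  refine Iff.trans (hasDerivWithinAt_pi (φ := A) (φ' := A')) (forall_congr' fun i => ?_)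
  exact hasDerivWithinAt_pi (φ := fun x => A x i) (φ' := A' i)

theorem hasDerivWithinAt_matrix_mono {s' : Set ℝ} (hA : HasDerivWithinAt A A' s t) (hs : s' ⊆ s) :
    HasDerivWithinAt A A' s' t :=
  hasDerivWithinAt_matrix_iff.2 fun i j => (hasDerivWithinAt_matrix_iff.1 hA i j).mono hs

theorem hasDerivWithinAt_matrix_mul (hA : HasDerivWithinAt A A' s t)
    (hB : HasDerivWithinAt B B' s t) :
    HasDerivWithinAt (fun x => A x * B x) (A' * B t + A t * B') s t := by
  rw [hasDerivWithinAt_matrix_iff] at *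
  intro i j
  simp only [mul_apply, Matrix.add_apply, ← Finset.sum_add_distrib]
  exact HasDerivWithinAt.fun_sum fun k _ => (hA i k).fun_mul (hB k j)

theorem hasDerivWithinAt_matrix_transpose (hA : HasDerivWithinAt A A' s t) :
    HasDerivWithinAt (fun x => (A x)ᵀ) A'ᵀ s t := by
  rw [hasDerivWithinAt_matrix_iff] at *
  exact fun i j => hA j i

theorem hasDerivWithinAt_matrix_trace (hA : HasDerivWithinAt A A' s t) :
    HasDerivWithinAt (fun x => (A x).trace) A'.trace s t := by
  rw [hasDerivWithinAt_matrix_iff] at *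
  exact HasDerivWithinAt.fun_sum fun i _ => hA i i

theorem hasDerivWithinAt_matrix_det (hA : HasDerivWithinAt A A' s t) :
    HasDerivWithinAt (fun x => (A x).det) ((A t).adjugate * A').trace s t := by
  rw [hasDerivWithinAt_matrix_iff] at *
  simp only [det_fin_three]
  have := (((((((hA 0 0).fun_mul (hA 1 1)).fun_mul (hA 2 2)).fun_sub
    (((hA 0 0).fun_mul (hA 1 2)).fun_mul (hA 2 1))).fun_sub
    (((hA 0 1).fun_mul (hA 1 0)).fun_mul (hA 2 2))).fun_add
    (((hA 0 1).fun_mul (hA 1 2)).fun_mul (hA 2 0))).fun_add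
    (((hA 0 2).fun_mul (hA 1 0)).fun_mul (hA 2 1))).fun_sub
    (((hA 0 2).fun_mul (hA 1 1)).fun_mul (hA 2 0))
  refine this.congr_deriv ?_
  simp only [adjugate_fin_three, trace_fin_three, mul_apply, Fin.sum_univ_three, of_apply,
    cons_val', cons_val_zero, cons_val_one, cons_val, cons_val_fin_one]
  ring

theorem hasDerivWithinAt_matrix_inv (hA : HasDerivWithinAt A A' s t) (hdet : (A t).det ≠ 0) :
    HasDerivWithinAt (fun x => (A x)⁻¹) (-((A t)⁻¹ * A' * (A t)⁻¹)) s t := by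
  -- A submultiplicative norm is chosen locally, so that the derivative of inversion in a complete
  -- normed algebra applies.
  let : NormedRing Mat3 := Matrix.linftyOpNormedRing
  let : NormedAlgebra ℝ Mat3 := Matrix.linftyOpNormedAlgebra
  have hu : IsUnit (A t) := (isUnit_iff_isUnit_det _).2 hdet.isUnit
  obtain ⟨u, hu⟩ := hu
  have h := hasFDerivAt_ringInverse (𝕜 := ℝ) (R := Mat3) u
  rw [hu] at h
  have h2 := h.comp_hasDerivWithinAt (f := A) t hA
  have e : (fun x => (A x)⁻¹) = Ring.inverse ∘ A := by
    funext x; exact nonsing_inv_eq_ringInverse (A x)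
  rw [e]
  refine h2.congr_deriv ?_
  simp [← hu, coe_units_inv]

end MatrixCalculus

end SpinorFlow

/-! ### Global existence for autonomous ODEs. -/

section GlobalSolutions

open Set Metric NNReal

variable {E : Type*} [NormedAddCommGroup E] [NormedSpace ℝ E]

/-- A field bounded by `L` moves a solution by at most `L (n + 1)` in time `n + 1`, so
Picard-Lindelöf works on every `[-(n+1), n+1]`; uniqueness glues these solutions. -/
theorem exists_forall_hasDerivAt_of_lipschitzWith [CompleteSpace E] {f : E → E} {K L : ℝ≥0}
    (hl : LipschitzWith K f) (hb : ∀ x, ‖f x‖ ≤ L) (x₀ : E) :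
    ∃ α : ℝ → E, α 0 = x₀ ∧ ∀ t, HasDerivAt α (f (α t)) t := by
  have key : ∀ n : ℕ, ∃ α : ℝ → E, α 0 = x₀ ∧
      ∀ t ∈ Icc (-(n + 1 : ℝ)) (n + 1), HasDerivWithinAt α (f (α t)) (Icc (-(n + 1 : ℝ)) (n + 1)) t := by
    intro n
    have h0 : (0 : ℝ) ∈ Icc (-(n + 1 : ℝ)) (n + 1) := by constructor <;> linarith [n.cast_nonneg (α := ℝ)]
    have := IsPicardLindelof.of_time_independent (f := f) (t₀ := ⟨0, h0⟩) (x₀ := x₀)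
      (a := L * (n + 1)) (r := 0) (L := L) (K := K) (fun x _ => hb x) hl.lipschitzOnWith
      (by simp)
    exact this.exists_eq_forall_mem_Icc_hasDerivWithinAt₀
  choose α hα0 hα using key
  have hI : ∀ n : ℕ, ∀ t ∈ Ioo (-(n + 1 : ℝ)) (n + 1), HasDerivAt (α n) (f (α n t)) t :=
    fun n t ht => (hα n t (Ioo_subset_Icc_self ht)).hasDerivAt (Icc_mem_nhds ht.1 ht.2)
  have huniq : ∀ m n : ℕ, m ≤ n → EqOn (α m) (α n) (Ioo (-(m + 1 : ℝ)) (m + 1)) := by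
    intro m n hmn
    have hmn' : (m : ℝ) ≤ n := by exact_mod_cast hmn
    refine ODE_solution_unique_of_mem_Ioo (v := fun _ => f) (s := fun _ => univ) (K := K)
      (t₀ := 0) (fun _ _ => hl.lipschitzOnWith) ?_ (fun t ht => ⟨hI m t ht, mem_univ _⟩)
      (fun t ht => ⟨hI n t ⟨by linarith [ht.1], by linarith [ht.2]⟩, mem_univ _⟩) ?_
    · constructor <;> linarith [m.cast_nonneg (α := ℝ)]
    · rw [hα0, hα0]
  have hmem : ∀ t : ℝ, ∀ n : ℕ, ⌈|t|⌉₊ ≤ n → t ∈ Ioo (-(n + 1 : ℝ)) (n + 1) := by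
    intro t n hn
    have h1 : |t| ≤ n := (Nat.le_ceil _).trans (by exact_mod_cast hn)
    exact abs_lt.1 (by linarith)
  -- The interval of index `⌈|t|⌉₊` contains `t` in its interior because its half-length is one
  -- larger than the index.
  refine ⟨fun t => α ⌈|t|⌉₊ t, hα0 _, fun t => ?_⟩
  set N := ⌈|t|⌉₊ with hN
  have heq : (fun x => α ⌈|x|⌉₊ x) =ᶠ[𝓝 t] α N := by
    filter_upwards [isOpen_Ioo.mem_nhds (hmem t N le_rfl)] with x hx
    rcases le_total ⌈|x|⌉₊ N with h | h
    · exact huniq _ _ h (hmem x _ le_rfl)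
    · exact (huniq _ _ h hx).symm
  exact (hI N t (hmem t N le_rfl)).congr_of_eventuallyEq heq

/-- A `C¹` vector field admitting a Lyapunov function with bounded sublevel sets is complete in
positive time. -/
theorem exists_forall_hasDerivAt_of_lyapunov [FiniteDimensional ℝ E] {f : E → E} {q : E → ℝ}
    (hf : ContDiff ℝ 1 f) (hq : Differentiable ℝ q) (hqf : ∀ x, fderiv ℝ q x (f x) ≤ 0)
    (hbdd : ∀ c, ∃ r, ∀ x, q x ≤ c → ‖x‖ ≤ r) (x₀ : E) :
    ∃ α : ℝ → E, α 0 = x₀ ∧ ∀ t, 0 ≤ t → HasDerivAt α (f (α t)) t := by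
  have : CompleteSpace E := FiniteDimensional.complete ℝ E
  obtain ⟨r, hr⟩ := hbdd (q x₀)
  -- Cutting off makes the field bounded and Lipschitz. As `χ ≥ 0`, `q` still decreases, so the
  -- orbit stays in the ball where `χ = 1` and solves the original equation. The absolute value
  -- keeps the radii positive.
  let χ : ContDiffBump (0 : E) := ⟨|r| + 1, |r| + 2, by positivity, by linarith⟩
  have hcd : ContDiff ℝ 1 (fun x => χ x • f x) := χ.contDiff.smul hf
  have hcs : HasCompactSupport (fun x => χ x • f x) := χ.hasCompactSupport.smul_right
  obtain ⟨K, hK⟩ := hcd.lipschitzWith_of_hasCompactSupport hcs one_ne_zero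
  obtain ⟨L, hL⟩ := hcs.exists_bound_of_continuous hcd.continuous
  obtain ⟨α, hα0, hα⟩ := exists_forall_hasDerivAt_of_lipschitzWith (L := L.toNNReal) hK
    (fun x => (hL x).trans (Real.le_coe_toNNReal L)) x₀
  refine ⟨α, hα0, fun t ht => ?_⟩
  have hd : ∀ s, HasDerivAt (fun s => q (α s)) (fderiv ℝ q (α s) (χ (α s) • f (α s))) s :=
    fun s => (hq (α s)).hasFDerivAt.comp_hasDerivAt s (hα s)
  have hanti : Antitone fun s => q (α s) := by
    refine antitone_of_deriv_nonpos (fun s => (hd s).differentiableAt) fun s => ?_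
    rw [(hd s).deriv, map_smul]
    exact mul_nonpos_of_nonneg_of_nonpos χ.nonneg (hqf _)
  have hle : ‖α t‖ ≤ r := hr _ (by simpa [hα0] using hanti ht)
  have h1 : χ (α t) = 1 := by
    apply χ.one_of_mem_closedBall
    rw [mem_closedBall_zero_iff]
    exact hle.trans ((le_abs_self r).trans (by simp [χ]))
  simpa [h1] using hα t

end GlobalSolutions

/-! ### Uniqueness for autonomous ODEs. -/

section Uniqueness

open Set Metric NNReal

variable {E : Type*} [NormedAddCommGroup E] [NormedSpace ℝ E]

theorem eqOn_Ico_of_hasDerivWithinAt [FiniteDimensional ℝ E] {f : E → E} (hf : ContDiff ℝ 1 f)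
    {T : ℝ} {α β : ℝ → E} (hα : ∀ t ∈ Ico 0 T, HasDerivWithinAt α (f (α t)) (Ico 0 T) t)
    (hβ : ∀ t ∈ Ico 0 T, HasDerivWithinAt β (f (β t)) (Ico 0 T) t) (h0 : α 0 = β 0) :
    EqOn α β (Ico 0 T) := by
  intro t ht
  have : ProperSpace E := FiniteDimensional.proper ℝ E
  have hsub : Icc 0 t ⊆ Ico 0 T := fun s hs => ⟨hs.1, hs.2.trans_lt ht.2⟩
  -- A `C¹` field is only locally Lipschitz, but on `[0, t]` both trajectories stay in one closed
  -- ball, where a Lipschitz constant exists.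
  have hcα : ContinuousOn α (Icc 0 t) := fun s hs => (hα s (hsub hs)).continuousWithinAt.mono hsub
  have hcβ : ContinuousOn β (Icc 0 t) := fun s hs => (hβ s (hsub hs)).continuousWithinAt.mono hsub
  obtain ⟨r, hr⟩ := ((isCompact_Icc.image_of_continuousOn hcα).union
    (isCompact_Icc.image_of_continuousOn hcβ)).isBounded.subset_closedBall 0
  obtain ⟨K, hK⟩ := hf.contDiffOn.exists_lipschitzOnWith one_ne_zero
    (convex_closedBall (0 : E) r) (isCompact_closedBall 0 r)
  have hnhds : ∀ s ∈ Ico 0 t, Ico 0 T ∈ 𝓝[≥] s := fun s hs =>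
    Filter.mem_of_superset (Ico_mem_nhdsGE (hs.2.trans ht.2)) (Ico_subset_Ico_left hs.1)
  exact ODE_solution_unique_of_mem_Icc_right (v := fun _ => f) (s := fun _ => closedBall 0 r)
    (fun _ _ => hK) hcα
    (fun s hs => (hα s (hsub (Ico_subset_Icc_self hs))).mono_of_mem_nhdsWithin (hnhds s hs))
    (fun s hs => hr (Or.inl (mem_image_of_mem α (Ico_subset_Icc_self hs)))) hcβ
    (fun s hs => (hβ s (hsub (Ico_subset_Icc_self hs))).mono_of_mem_nhdsWithin (hnhds s hs))
    (fun s hs => hr (Or.inr (mem_image_of_mem β (Ico_subset_Icc_self hs)))) h0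
    (right_mem_Icc.2 ht.1)

theorem Convex.eq_of_hasDerivWithinAt_zero {s : Set ℝ} (hs : Convex ℝ s) {u : ℝ → E}
    (hu : ∀ t ∈ s, HasDerivWithinAt u 0 s t) {x y : ℝ} (hx : x ∈ s) (hy : y ∈ s) : u y = u x := by
  have := hs.norm_image_sub_le_of_norm_hasDerivWithin_le (C := 0) hu (by simp) hx hy
  rw [zero_mul, norm_le_zero_iff, sub_eq_zero] at this
  exact this

end Uniqueness

/-! ### The energy as a function of the metric, and the round metric. -/

namespace SpinorFlow

theorem toLp_clif_apply (j : Fin 3) (φ : Spinor) (i : Fin 2) :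
    (clif j φ) i = (cliffordGen j *ᵥ φ.ofLp) i := rfl

/-- A skew combination of products of two Clifford generators is a combination of generators. -/
theorem sum_skew_smul_clif_clif {G : Fin 3 → Fin 3 → ℝ} (hG : ∀ j k, G j k = -G k j)
    (φ : Spinor) :
    ∑ j, ∑ k, G j k • clif j (clif k φ)
      = (-2 : ℝ) • (G 1 2 • clif 0 φ + G 2 0 • clif 1 φ + G 0 1 • clif 2 φ) := by
  have h0 : ∀ j, G j j = 0 := fun j => by linarith [hG j j]
  simp only [Fin.sum_univ_three, h0, hG 1 0, hG 0 2, hG 2 1]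
  ext i
  fin_cases i <;>
  · simp [toLp_clif_apply, cliffordGen, mulVec, dotProduct, Fin.sum_univ_two]
    ring_nf
    simp
    try ring

/-- A real Clifford vector `w` is skew-Hermitian with square `-|w|²`, hence `|w|` times an isometry.
This is why the energy ignores the direction of `φ`. -/
theorem norm_sq_sum_smul_clif (w : Fin 3 → ℝ) (φ : Spinor) :
    ‖w 0 • clif 0 φ + w 1 • clif 1 φ + w 2 • clif 2 φ‖ ^ 2
      = (w 0 ^ 2 + w 1 ^ 2 + w 2 ^ 2) * ‖φ‖ ^ 2 := by
  simp only [EuclideanSpace.norm_sq_eq, Fin.sum_univ_two, ← Complex.normSq_eq_norm_sq]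
  simp [toLp_clif_apply, cliffordGen, mulVec, dotProduct, Fin.sum_univ_two, Complex.normSq_apply]
  ring

section LieAlgebra

variable {𝔤 : Type*} [LieRing 𝔤] [LieAlgebra ℝ 𝔤] {X : Module.Basis (Fin 3) ℝ 𝔤}

/-- The bracket in a standard basis is the cross product. -/
theorem IsStandardBasis.repr_lie (hX : IsStandardBasis X) (U V : 𝔤) :
    (X.repr ⁅U, V⁆ : Fin 3 → ℝ) = crossProduct (X.repr U : Fin 3 → ℝ) (X.repr V) := by
  obtain ⟨h01, h12, h20⟩ := hX
  have h10 : ⁅X 1, X 0⁆ = -X 2 := by rw [← lie_skew, h01]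
  have h21 : ⁅X 2, X 1⁆ = -X 0 := by rw [← lie_skew, h12]
  have h02 : ⁅X 0, X 2⁆ = -X 1 := by rw [← lie_skew, h20]
  conv_lhs => rw [← X.sum_repr U, ← X.sum_repr V]
  simp only [Fin.sum_univ_three, add_lie, lie_add, smul_lie, lie_smul, lie_self, h01, h12, h20,
    h10, h21, h02]
  ext i
  fin_cases i <;>
  · simp [cross_apply]
    ring

theorem repr_frame (A : Mat3) (i : Fin 3) : (X.repr (frame X A i) : Fin 3 → ℝ) = fun j => A j i := by
  ext j
  simp [frame, Fin.sum_univ_three, Finsupp.single_apply]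
  fin_cases j <;> simp

theorem metricForm_frame {A : Mat3} (hA : A.det ≠ 0) (U : 𝔤) (k : Fin 3) :
    metricForm X A U (frame X A k) = (A⁻¹ *ᵥ X.repr U) k := by
  have h : metricOf A *ᵥ (fun j => A j k) = fun j => A⁻¹ k j := by
    have : metricOf A * A = (A⁻¹)ᵀ := by
      rw [metricOf, Matrix.mul_assoc, nonsing_inv_mul _ hA.isUnit, Matrix.mul_one]
    ext j
    exact congrFun (congrFun this j) k
  rw [metricForm, repr_frame, h, dotProduct_comm]
  rfl

theorem metricForm_neg_left (A : Mat3) (U V : 𝔤) :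
    metricForm X A (-U) V = -metricForm X A U V := by
  simp [metricForm]

theorem koszul_skew (A : Mat3) (U V W : 𝔤) : koszul X A U V W = -koszul X A U W V := by
  rw [koszul, koszul, ← lie_skew U W, ← lie_skew W V, ← lie_skew V U]
  simp only [metricForm_neg_left]
  ring

theorem spinDeriv_eq (A : Mat3) (φ : Spinor) (U : 𝔤) :
    spinDeriv X A φ U = (-(1 / 2) : ℝ) •
      (koszul X A U (frame X A 1) (frame X A 2) • clif 0 φ
        + koszul X A U (frame X A 2) (frame X A 0) • clif 1 φ
        + koszul X A U (frame X A 0) (frame X A 1) • clif 2 φ) := by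
  rw [spinDeriv, sum_skew_smul_clif_clif (fun j k => koszul_skew A U _ _), smul_smul]
  norm_num

/-- The case of basis vectors of `Ax × Ay = cof(A)(x × y)`, with the cofactor matrix written as
`A.adjugateᵀ`. -/
theorem cross_col (A : Mat3) (i j : Fin 3) :
    crossProduct (fun l => A l i) (fun l => A l j)
      = A.adjugateᵀ *ᵥ crossProduct (Pi.single i 1) (Pi.single j (1 : ℝ)) := by
  ext k
  rw [adjugate_fin_three]
  fin_cases i <;> fin_cases j <;> fin_cases k <;>
  · simp [cross_apply, mulVec, dotProduct, Fin.sum_univ_three]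
    try ring

/-- The structure constants of the frame `Y = AX`. -/
theorem IsStandardBasis.metricForm_lie_frame (hX : IsStandardBasis X) {A : Mat3} (hA : A.det ≠ 0)
    (i j k : Fin 3) :
    metricForm X A ⁅frame X A i, frame X A j⁆ (frame X A k)
      = ((A.det • (A⁻¹ * (A⁻¹)ᵀ)) *ᵥ
          crossProduct (Pi.single i 1) (Pi.single j (1 : ℝ))) k := by
  have hadj : A.adjugate = A.det • A⁻¹ := by
    rw [inv_def, smul_smul, Ring.inverse_eq_inv', mul_inv_cancel₀ hA, one_smul]
  rw [metricForm_frame hA, hX.repr_lie, repr_frame, repr_frame, cross_col, hadj, mulVec_mulVec,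
    transpose_smul, Matrix.mul_smul]

/-- The density of the energy as a function of the metric, up to a constant. -/
noncomputable def energyPoly (g : Mat3) : ℝ := (g * g).trace - (1 / 4) * g.trace ^ 2

theorem IsStandardBasis.energy_eq (hX : IsStandardBasis X) {A : Mat3} (hA : A.det ≠ 0)
    (φ : Spinor) :
    energy X A φ = (1 / 8) * ‖φ‖ ^ 2 * A.det * energyPoly (metricOf A) := by
  -- The structure constants involve `S = A⁻¹A⁻ᵀ` rather than `g = A⁻ᵀA⁻¹`; the two have the same
  -- traces of powers.
  have htr : (metricOf A).trace = (A⁻¹ * (A⁻¹)ᵀ).trace := by rw [metricOf, trace_mul_comm]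
  have htr2 : (metricOf A * metricOf A).trace = (A⁻¹ * (A⁻¹)ᵀ * (A⁻¹ * (A⁻¹)ᵀ)).trace := by
    rw [metricOf, Matrix.mul_assoc, trace_mul_comm]
    simp only [Matrix.mul_assoc]
  have hsymm : (A⁻¹ * (A⁻¹)ᵀ).IsSymm := by simp [IsSymm]
  rw [energyPoly, htr, htr2, energy, vol]
  have key := fun i j k => hX.metricForm_lie_frame hA i j k
  generalize A⁻¹ * (A⁻¹)ᵀ = S at key hsymm
  have h01 := hsymm.apply 0 1
  have h02 := hsymm.apply 0 2
  have h12 := hsymm.apply 1 2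
  have hn : ∀ i, ‖spinDeriv X A φ (frame X A i)‖ ^ 2 = (1 / 4) *
      ((koszul X A (frame X A i) (frame X A 1) (frame X A 2)) ^ 2
        + (koszul X A (frame X A i) (frame X A 2) (frame X A 0)) ^ 2
        + (koszul X A (frame X A i) (frame X A 0) (frame X A 1)) ^ 2) * ‖φ‖ ^ 2 := by
    intro i
    rw [spinDeriv_eq, norm_smul, mul_pow]
    have := norm_sq_sum_smul_clif ![koszul X A (frame X A i) (frame X A 1) (frame X A 2),
      koszul X A (frame X A i) (frame X A 2) (frame X A 0),
      koszul X A (frame X A i) (frame X A 0) (frame X A 1)] φ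
    simp only [cons_val_zero, cons_val_one, cons_val] at this
    rw [this]
    norm_num
    ring
  simp only [hn, Fin.sum_univ_three, koszul, key]
  simp [cross_apply, mulVec, dotProduct, Fin.sum_univ_three, mul_apply, trace_fin_three, h01, h02,
    h12]
  field_simp
  ring

theorem metricOf_one : metricOf 1 = 1 := by simp [metricOf]

theorem frame_one (i : Fin 3) : frame X 1 i = X i := by
  simp [frame, one_apply]

theorem metricForm_one (U V : 𝔤) :
    metricForm X 1 U V = (X.repr U : Fin 3 → ℝ) ⬝ᵥ X.repr V := by
  rw [metricForm, metricOf_one, one_mulVec]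

/-- The metric `ḡ` is bi-invariant, so the last two Koszul terms cancel. -/
theorem IsStandardBasis.leviCivita_one (hX : IsStandardBasis X) (U V : 𝔤) :
    leviCivita X 1 U V = (1 / 2 : ℝ) • ⁅U, V⁆ := by
  apply X.repr.injective
  ext k
  simp only [leviCivita, koszul, metricForm_one, hX.repr_lie, frame_one, map_sum, map_smul]
  fin_cases k <;>
  · simp [cross_apply, Fin.sum_univ_three, Finsupp.single_apply, dotProduct, hX.repr_lie]
    ring

theorem IsStandardBasis.isRound (hX : IsStandardBasis X) : IsRound X 1 := by
  refine ⟨1 / 4, by norm_num, fun U V W => ?_⟩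
  simp only [curvature, hX.leviCivita_one]
  apply X.repr.injective
  ext k
  fin_cases k <;>
  · simp [cross_apply, Fin.sum_univ_three, dotProduct, hX.repr_lie, metricForm_one]
    ring

theorem IsStandardBasis.isKillingSpinor (hX : IsStandardBasis X) {φ : Spinor} (hφ : φ ≠ 0) :
    IsKillingSpinor X 1 φ := by
  refine ⟨hφ, -(1 / 4), by norm_num, fun U => ?_⟩
  have h : ∀ i, metricForm X 1 U (X i) = X.repr U i := by
    intro i
    simp [metricForm_one, dotProduct, Finsupp.single_apply]
  have hk : ∀ i j, koszul X 1 U (X i) (X j) =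
      (1 / 2) * crossProduct (Pi.single i 1) (Pi.single j (1 : ℝ)) ⬝ᵥ (X.repr U : Fin 3 → ℝ) := by
    intro i j
    simp only [koszul, metricForm_one, hX.repr_lie]
    fin_cases i <;> fin_cases j <;>
    · simp [cross_apply, Fin.sum_univ_three, Finsupp.single_apply, dotProduct]
      try ring
  rw [spinDeriv_eq, cliffordMul]
  simp only [frame_one, h, hk, Fin.sum_univ_three]
  simp [cross_apply, dotProduct, Fin.sum_univ_three]
  module

end LieAlgebra

end SpinorFlow

/-! ### The gradient of the energy. -/

namespace SpinorFlow

/-- The polynomial `P` with `Q̃₁ = -⅛ det(g)⁻¹ g P(g)`. -/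
noncomputable def flowPoly (g : Mat3) : Mat3 :=
  (2 : ℝ) • (g * g) - ((1 / 2) * g.trace) • g - ((2 / 3) * energyPoly g) • 1

/-- The metric component `Q̃₁` of the volume-normalized spinor flow at `[A, φ]`, `‖φ‖ = 1`. -/
noncomputable def metricVelocity (A : Mat3) : Mat3 :=
  (-(1 / 8) * A.det ^ 2) • (metricOf A * flowPoly (metricOf A))

theorem metricOf_isSymm (A : Mat3) : (metricOf A).IsSymm := by simp [metricOf, IsSymm]

theorem metricOf_inv {A : Mat3} (hA : A.det ≠ 0) : (metricOf A)⁻¹ = A * Aᵀ := by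
  rw [metricOf, Matrix.mul_inv_rev, ← transpose_nonsing_inv, nonsing_inv_nonsing_inv _ hA.isUnit]

theorem hasDerivWithinAt_metricOf {A : ℝ → Mat3} {A' : Mat3} {s : Set ℝ} {t : ℝ}
    (hA : HasDerivWithinAt A A' s t) (hdet : (A t).det ≠ 0) :
    HasDerivWithinAt (fun x => metricOf (A x)) (metricVariation (A t) A') s t := by
  have h := hasDerivWithinAt_matrix_inv hA hdet
  have e : metricVariation (A t) A' = (-((A t)⁻¹ * A' * (A t)⁻¹))ᵀ * (A t)⁻¹
      + ((A t)⁻¹)ᵀ * -((A t)⁻¹ * A' * (A t)⁻¹) := by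
    simp only [metricVariation, metricOf, transpose_neg, transpose_mul, transpose_transpose,
      Matrix.mul_assoc, Matrix.neg_mul, Matrix.mul_neg, neg_add]
  rw [e]
  exact hasDerivWithinAt_matrix_mul (hasDerivWithinAt_matrix_transpose h) h

theorem metricOf_mul_flowPoly_isSymm (A : Mat3) :
    (metricOf A * flowPoly (metricOf A)).IsSymm := by
  have h : (metricOf A)ᵀ = metricOf A := metricOf_isSymm A
  simp only [IsSymm, flowPoly, Matrix.mul_sub, transpose_sub, transpose_mul, transpose_smul,
    Matrix.mul_smul, Matrix.mul_one, h, Matrix.mul_assoc]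

section LieAlgebra

variable {𝔤 : Type*} [LieRing 𝔤] [LieAlgebra ℝ 𝔤] {X : Module.Basis (Fin 3) ℝ 𝔤}

theorem IsStandardBasis.hasDerivAt_energy (hX : IsStandardBasis X) {A : Mat3} (hA : A.det ≠ 0)
    {φ : Spinor} (hφ : ‖φ‖ = 1) (M : Mat3) :
    HasDerivAt (fun s : ℝ => energy X (A + s • M) φ)
      (-tensorInner A (metricVelocity A - ((1 / 6) * (energy X A φ / vol A)) • metricOf A)
        (metricVariation A M)) 0 := by
  have hline : HasDerivWithinAt (fun s : ℝ => A + s • M) M Set.univ 0 := by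
    rw [hasDerivWithinAt_matrix_iff]
    intro i j
    simpa using ((hasDerivWithinAt_id (0 : ℝ) Set.univ).mul_const (M i j)).const_add (A i j)
  have hdet := hasDerivWithinAt_matrix_det hline
  have h0 : A + (0 : ℝ) • M = A := by simp
  have hmet := hasDerivWithinAt_metricOf hline (by rwa [h0])
  have hsq := hasDerivWithinAt_matrix_trace (hasDerivWithinAt_matrix_mul hmet hmet)
  have htr := hasDerivWithinAt_matrix_trace hmet
  rw [h0] at hdet hmet hsq htr
  have hpoly : HasDerivAt (fun s : ℝ => (1 / 8) * ‖φ‖ ^ 2 * (A + s • M).det *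
      energyPoly (metricOf (A + s • M))) _ 0 := hasDerivWithinAt_univ.1
    (((hdet.const_mul ((1 / 8) * ‖φ‖ ^ 2))).fun_mul (hsq.fun_sub ((htr.fun_pow 2).const_mul (1 / 4))))
  have hne : ∀ᶠ s : ℝ in 𝓝 0, (A + s • M).det ≠ 0 := by
    have hc := (hasDerivWithinAt_univ.1 hdet).continuousAt
    exact hc.eventually_ne (by simpa using hA)
  refine (hpoly.congr_of_eventuallyEq (hne.mono fun s hs => hX.energy_eq hs φ)).congr_deriv ?_
  rw [h0, hX.energy_eq hA, hφ]
  have hadj : A.adjugate = A.det • A⁻¹ := by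
    rw [inv_def, smul_smul, Ring.inverse_eq_inv', mul_inv_cancel₀ hA, one_smul]
  have hgdet : IsUnit (metricOf A).det := by
    rw [metricOf, det_mul, det_transpose, det_nonsing_inv, Ring.inverse_eq_inv']
    exact (mul_ne_zero (inv_ne_zero hA) (inv_ne_zero hA)).isUnit
  have hginv : (metricOf A)⁻¹ * metricOf A = 1 := nonsing_inv_mul _ hgdet
  have hginv' : metricOf A * (metricOf A)⁻¹ = 1 := mul_nonsing_inv _ hgdet
  have hH : ((metricOf A)⁻¹ * metricVariation A M).trace = -2 * (A⁻¹ * M).trace := by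
    have e : (metricVariation A M) = -(metricOf A * M * A⁻¹ + (A⁻¹)ᵀ * Mᵀ * metricOf A) := by
      rw [metricVariation, transpose_mul, transpose_mul, (metricOf_isSymm A).eq, add_comm,
        Matrix.mul_assoc ((A⁻¹)ᵀ)]
    rw [e, Matrix.mul_neg, Matrix.mul_add, trace_neg, trace_add]
    rw [← Matrix.mul_assoc, ← Matrix.mul_assoc, hginv, Matrix.one_mul, trace_mul_comm M]
    rw [trace_mul_comm ((metricOf A)⁻¹), Matrix.mul_assoc, hginv', Matrix.mul_one,
      ← transpose_mul, trace_transpose, trace_mul_comm M]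
    ring
  -- Removing the normalization term changes the coefficient `2/3` of `F` in `flowPoly` to `2/3 -
  -- 1/6 = 1/2`. This matches the variation of the factor `det A`, which is `-½ det A · tr(g⁻¹H)` by
  -- `hH`.
  have hrhs : tensorInner A (metricVelocity A -
      ((1 / 6) * ((1 / 8) * 1 ^ 2 * A.det * energyPoly (metricOf A) / vol A)) • metricOf A)
      (metricVariation A M) = (-(1 / 8) * A.det) * (2 * (metricOf A * metricVariation A M).trace
        - (1 / 2) * (metricOf A).trace * (metricVariation A M).trace
        - (1 / 2) * energyPoly (metricOf A) * ((metricOf A)⁻¹ * metricVariation A M).trace) := by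
    generalize metricVariation A M = H
    rw [tensorInner, metricVelocity, flowPoly, vol]
    generalize energyPoly (metricOf A) = F
    generalize metricOf A = g at *
    have e : (g⁻¹ * (((-(1 / 8) * A.det ^ 2) • (g * ((2 : ℝ) • (g * g) - ((1 / 2) * g.trace) • g
        - ((2 / 3) * F) • 1)) - ((1 / 6) * ((1 / 8) * 1 ^ 2 * A.det * F / (1 / A.det))) • g) * g⁻¹))
        = (-(1 / 8) * A.det ^ 2) • ((2 : ℝ) • g - ((1 / 2) * g.trace) • 1 - ((1 / 2) * F) • g⁻¹) := by
      simp only [Matrix.mul_sub, Matrix.sub_mul, Matrix.mul_smul, Matrix.smul_mul, Matrix.mul_one,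
        Matrix.mul_assoc, hginv']
      simp only [← Matrix.mul_assoc, hginv, Matrix.one_mul]
      field_simp
      module
    rw [trace_mul_comm, ← Matrix.mul_assoc, ← Matrix.mul_assoc, Matrix.mul_assoc g⁻¹, e]
    simp only [Matrix.sub_mul, Matrix.smul_mul, Matrix.one_mul, trace_sub, trace_smul, smul_eq_mul]
    field_simp
  rw [hrhs, hH, hadj, Matrix.smul_mul, trace_smul, trace_add, trace_mul_comm (metricVariation A M),
    energyPoly]
  simp only [smul_eq_mul]
  push_cast
  ring

theorem IsStandardBasis.hasDerivAt_energy_spinor (hX : IsStandardBasis X) {A : Mat3}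
    (hA : A.det ≠ 0) {φ ψ : Spinor} (h : (inner ℂ φ ψ).re = 0) :
    HasDerivAt (fun s : ℝ => energy X A (φ + s • ψ)) 0 0 := by
  have e : (fun s : ℝ => energy X A (φ + s • ψ)) = fun s : ℝ =>
      (1 / 8) * (‖φ‖ ^ 2 + s ^ 2 * ‖ψ‖ ^ 2) * A.det * energyPoly (metricOf A) := by
    funext s
    have hs : (s • ψ : Spinor) = ((s : ℂ) • ψ) := by ext i; simp
    rw [hX.energy_eq hA, norm_add_sq (𝕜 := ℂ), norm_smul, hs, inner_smul_right]
    simp [h, mul_pow]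
  rw [e]
  have := ((((((hasDerivAt_pow 2 (0 : ℝ)).mul_const (‖ψ‖ ^ 2)).const_add (‖φ‖ ^ 2)).const_mul
    (1 / 8)).mul_const A.det).mul_const (energyPoly (metricOf A)))
  simpa using this

theorem IsStandardBasis.isNormalizedVelocity (hX : IsStandardBasis X) {A : Mat3}
    (hA : A.det ≠ 0) {φ : Spinor} (hφ : ‖φ‖ = 1) :
    IsNormalizedVelocity X A φ (metricVelocity A) 0 := by
  refine ⟨?_, fun M _ => hX.hasDerivAt_energy hA hφ M, by simp, fun ψ hψ => ?_⟩
  · exact ((metricOf_mul_flowPoly_isSymm A).smul _).sub ((metricOf_isSymm A).smul _)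
  · simpa [spinorInner] using hX.hasDerivAt_energy_spinor hA hψ

/-- Horizontal variations reach every symmetric tensor. Testing with `M = A K`, `K = Aᵀ q A`, turns
the pairing into a nonzero multiple of `tr (KᵀK)`. -/
theorem eq_zero_of_tensorInner_eq_zero {A q : Mat3} (hA : A.det ≠ 0) (hq : q.IsSymm)
    (h : ∀ M, IsHorizontal A M → tensorInner A q (metricVariation A M) = 0) : q = 0 := by
  have hu : IsUnit A.det := hA.isUnit
  have h1 : A⁻¹ * A = 1 := nonsing_inv_mul _ hu
  have h2 : A * A⁻¹ = 1 := mul_nonsing_inv _ hu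
  have h1t : Aᵀ * (A⁻¹)ᵀ = 1 := by rw [← transpose_mul, h1, transpose_one]
  have h2t : (A⁻¹)ᵀ * Aᵀ = 1 := by rw [← transpose_mul, h2, transpose_one]
  obtain ⟨K, hK⟩ : ∃ K, K = Aᵀ * q * A := ⟨_, rfl⟩
  have hKs : Kᵀ = K := by
    rw [hK, transpose_mul, transpose_mul, transpose_transpose, hq.eq, Matrix.mul_assoc]
  have hvar : metricVariation A (A * K) = (-2 : ℝ) • ((A⁻¹)ᵀ * K * A⁻¹) := by
    have e : metricOf A * (A * K) * A⁻¹ = (A⁻¹)ᵀ * K * A⁻¹ := by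
      rw [metricOf, Matrix.mul_assoc ((A⁻¹)ᵀ), ← Matrix.mul_assoc A⁻¹ A, h1, Matrix.one_mul]
    rw [metricVariation, e, transpose_mul, transpose_mul, transpose_transpose, hKs,
      ← Matrix.mul_assoc]
    module
  have h0 := h (A * K) (by rw [IsHorizontal, ← Matrix.mul_assoc, h1, Matrix.one_mul]; exact hKs)
  have e2 : q * (A * Aᵀ) * ((A⁻¹)ᵀ * K * A⁻¹) * (A * Aᵀ) = q * A * K * Aᵀ := by
    calc _ = q * A * (Aᵀ * (A⁻¹)ᵀ) * K * (A⁻¹ * A) * Aᵀ := by simp only [Matrix.mul_assoc]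
      _ = _ := by rw [h1t, h1, Matrix.mul_one, Matrix.mul_one]
  rw [tensorInner, metricOf_inv hA, hvar, Matrix.mul_smul, Matrix.smul_mul, trace_smul, e2,
    trace_mul_comm, ← Matrix.mul_assoc Aᵀ, ← Matrix.mul_assoc Aᵀ, ← hK, vol] at h0
  have h3 : (Kᴴ * K).trace = 0 := by
    rw [conjTranspose_eq_transpose_of_trivial, hKs]
    simpa [hA] using h0
  have h4 : K = 0 := trace_conjTranspose_mul_self_eq_zero_iff.1 h3
  calc q = ((A⁻¹)ᵀ * Aᵀ) * q * (A * A⁻¹) := by rw [h2t, h2, Matrix.one_mul, Matrix.mul_one]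
    _ = (A⁻¹)ᵀ * K * A⁻¹ := by simp only [hK, Matrix.mul_assoc]
    _ = 0 := by rw [h4, Matrix.mul_zero, Matrix.zero_mul]

theorem IsStandardBasis.eq_of_isNormalizedVelocity (hX : IsStandardBasis X) {A : Mat3}
    (hA : A.det ≠ 0) {φ : Spinor} (hφ : ‖φ‖ = 1) {q₁ : Mat3} {q₂ : Spinor}
    (h : IsNormalizedVelocity X A φ q₁ q₂) : q₁ = metricVelocity A ∧ q₂ = 0 := by
  obtain ⟨hs, hg, hr, hsp⟩ := h
  obtain ⟨hs', hg', -, -⟩ := hX.isNormalizedVelocity hA hφ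
  constructor
  · rw [← sub_eq_zero, ← sub_sub_sub_cancel_right q₁ _
      (((1 / 6) * (energy X A φ / vol A)) • metricOf A)]
    refine eq_zero_of_tensorInner_eq_zero hA (hs.sub hs') fun M hM => ?_
    have := (hg M hM).unique (hg' M hM)
    rw [tensorInner, Matrix.sub_mul, Matrix.sub_mul, Matrix.sub_mul, trace_sub, sub_mul]
    rw [tensorInner, tensorInner] at this
    linarith
  -- The candidate `q₂` is itself an admissible direction, and pairing it with itself gives its
  -- squared norm.
  · have := (hsp q₂ hr).unique (hX.hasDerivAt_energy_spinor hA hr)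
    rw [spinorInner, vol, neg_eq_zero, mul_eq_zero, or_iff_left (one_div_ne_zero hA),
      inner_self_eq_norm_sq_to_K] at this
    have h2 : ‖q₂‖ ^ 2 = 0 := by exact_mod_cast this
    simpa using h2

end LieAlgebra

end SpinorFlow

/-! ### Trace inequalities for the Lyapunov function. -/

namespace SpinorFlow

section Algebra

/-- The infinitesimal form of volume preservation: the coefficient `2/3` in `flowPoly` is the one
that makes this vanish. -/
theorem trace_flowPoly (g : Mat3) : (flowPoly g).trace = 0 := by
  simp [flowPoly, energyPoly, trace_sub, trace_smul]
  ring

theorem trace_mul_flowPoly (g : Mat3) : (g * flowPoly g).trace =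
    2 * (g * g * g).trace - (7 / 6) * g.trace * (g * g).trace + (1 / 6) * g.trace ^ 3 := by
  simp only [flowPoly, energyPoly, Matrix.mul_sub, Matrix.mul_smul, Matrix.mul_one, trace_sub,
    trace_smul, smul_eq_mul, Matrix.mul_assoc]
  ring

theorem trace_transpose_mul_self_nonneg (C : Mat3) : 0 ≤ (Cᵀ * C).trace := by
  simp only [trace, diag_apply, mul_apply, transpose_apply]
  exact Finset.sum_nonneg fun i _ => Finset.sum_nonneg fun j _ => mul_self_nonneg _

/-- `tr (d g d) ≥ 0` for the trace-free part `d` of a positive semidefinite `g = CᵀC`. -/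
theorem trace_cube_ge (C : Mat3) {g : Mat3} (hg : g = Cᵀ * C) :
    (2 / 3) * g.trace * (g * g).trace - (1 / 9) * g.trace ^ 3 ≤ (g * g * g).trace := by
  have h := trace_transpose_mul_self_nonneg (C * (g - (g.trace / 3) • 1))
  have hs : gᵀ = g := by simp [hg]
  have e : (C * (g - (g.trace / 3) • 1))ᵀ * (C * (g - (g.trace / 3) • 1))
      = g * g * g - (2 * (g.trace / 3)) • (g * g) + ((g.trace / 3) ^ 2) • g := by
    have : (C * (g - (g.trace / 3) • 1))ᵀ * (C * (g - (g.trace / 3) • 1))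
        = (g - (g.trace / 3) • 1) * (Cᵀ * C) * (g - (g.trace / 3) • 1) := by
      rw [transpose_mul, transpose_sub, hs, transpose_smul, transpose_one]
      simp only [Matrix.mul_assoc]
    rw [this, ← hg]
    generalize g.trace = τ
    simp only [Matrix.sub_mul, Matrix.mul_sub, Matrix.mul_smul, Matrix.smul_mul, Matrix.one_mul,
      Matrix.mul_one]
    module
  rw [e] at h
  simp only [trace_add, trace_sub, trace_smul, smul_eq_mul] at h
  linarith

theorem trace_sq_ge {g : Mat3} (hg : g.IsSymm) : g.trace ^ 2 / 3 ≤ (g * g).trace := by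
  have h01 := hg.apply 0 1
  have h02 := hg.apply 0 2
  have h12 := hg.apply 1 2
  simp only [trace_fin_three, mul_apply, Fin.sum_univ_three, h01, h02, h12]
  nlinarith [sq_nonneg (g 0 0 - g 1 1), sq_nonneg (g 0 0 - g 2 2), sq_nonneg (g 1 1 - g 2 2),
    sq_nonneg (g 0 1), sq_nonneg (g 0 2), sq_nonneg (g 1 2)]

theorem trace_mul_flowPoly_ge (C : Mat3) {g : Mat3} (hg : g = Cᵀ * C) :
    (1 / 6) * (g.trace * ((g * g).trace - g.trace ^ 2 / 3)) ≤ (g * flowPoly g).trace := by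
  rw [trace_mul_flowPoly]
  linarith [trace_cube_ge C hg]

theorem trace_mul_flowPoly_nonneg (C : Mat3) {g : Mat3} (hg : g = Cᵀ * C) :
    0 ≤ (g * flowPoly g).trace := by
  refine le_trans ?_ (trace_mul_flowPoly_ge C hg)
  have h1 : 0 ≤ g.trace := by rw [hg]; exact trace_transpose_mul_self_nonneg C
  have h2 := trace_sq_ge (g := g) (by simp [hg, IsSymm])
  have := mul_nonneg h1 (sub_nonneg.2 h2)
  linarith

theorem six_mul_det (g : Mat3) :
    6 * g.det = g.trace ^ 3 - 3 * g.trace * (g * g).trace + 2 * (g * g * g).trace := by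
  simp only [det_fin_three, trace_fin_three, mul_apply, Fin.sum_univ_three]
  ring

theorem trace_sq_eq (g : Mat3) : (g * g).trace = g.trace ^ 2 - 2 * g.adjugate.trace := by
  simp [adjugate_fin_three, trace_fin_three, mul_apply, Fin.sum_univ_three]
  ring

/-- AM-GM for the nonnegative eigenvalues of `CᵀC`, whose product is one. -/
theorem three_le_trace {C : Mat3} (hC : C.det = 1) : 3 ≤ (Cᵀ * C).trace := by
  have hp : (Cᵀ * C).PosSemidef := by
    simpa [conjTranspose_eq_transpose_of_trivial] using posSemidef_conjTranspose_mul_self C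
  have hdet : (Cᵀ * C).det = 1 := by simp [hC]
  have ht := hp.isHermitian.trace_eq_sum_eigenvalues
  have hd := hp.isHermitian.det_eq_prod_eigenvalues
  have h0 := hp.eigenvalues_nonneg
  rw [hdet] at hd
  simp only [Fin.sum_univ_three, Fin.prod_univ_three, RCLike.ofReal_real_eq_id, id] at ht hd
  rw [ht]
  have hx := h0 0
  have hy := h0 1
  have hz := h0 2
  generalize hp.isHermitian.eigenvalues 0 = x at *
  generalize hp.isHermitian.eigenvalues 1 = y at *
  generalize hp.isHermitian.eigenvalues 2 = z at *
  by_contra! hlt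
  have h27 : 27 * (x * y * z) ≤ (x + y + z) ^ 3 := by
    nlinarith [mul_nonneg hx (sq_nonneg (y - z)), mul_nonneg hy (sq_nonneg (x - z)),
      mul_nonneg hz (sq_nonneg (x - y)), mul_nonneg (add_nonneg (add_nonneg hx hy) hz)
      (add_nonneg (add_nonneg (sq_nonneg (x - y)) (sq_nonneg (x - z))) (sq_nonneg (y - z)))]
  have h3 : (x + y + z) ^ 3 < 3 ^ 3 := pow_lt_pow_left₀ hlt (by positivity) (by norm_num)
  rw [← hd] at h27
  linarith

/-- With `p = tr g`, Newton's identity and `trace_cube_ge` bound `p · tr g²` below by `(7/15) p³ -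
18/5`. The previous bound then becomes `(p³ - 27)/45`, and `p³ - 27 ≥ 27 (p - 3)` for `p ≥ 3`. -/
theorem trace_mul_flowPoly_ge_of_det {C : Mat3} (hC : C.det = 1) :
    (3 / 5) * ((Cᵀ * C).trace - 3) ≤ (Cᵀ * C * flowPoly (Cᵀ * C)).trace := by
  have h1 := trace_mul_flowPoly_ge C rfl
  have h2 := trace_cube_ge C rfl
  have h3 := six_mul_det (Cᵀ * C)
  have h4 := three_le_trace hC
  have hdet : (Cᵀ * C).det = 1 := by simp [hC]
  rw [hdet] at h3
  generalize (Cᵀ * C).trace = p at *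
  nlinarith [mul_nonneg (sub_nonneg.2 h4) (mul_nonneg (sub_nonneg.2 h4) (sub_nonneg.2 h4)),
    mul_nonneg (sub_nonneg.2 h4) (sub_nonneg.2 h4)]

/-- The squared distance is `p² - 2e₂ - 2p + 3` with `p = tr g` and `e₂ = tr adj g`. Since `adj g`
is again a Gram matrix of determinant one, `e₂ ≥ 3`. -/
theorem matDist_sq_le {C : Mat3} (hC : C.det = 1) :
    matDist (Cᵀ * C) 1 ^ 2 ≤ ((Cᵀ * C).trace - 3) * ((Cᵀ * C).trace + 1) := by
  have hadj : (Cᵀ * C).adjugate.trace = ((C.adjugateᵀ)ᵀ * C.adjugateᵀ).trace := by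
    rw [adjugate_mul_distrib, ← adjugate_transpose, transpose_transpose]
  have h3 : 3 ≤ (Cᵀ * C).adjugate.trace := by
    rw [hadj]
    exact three_le_trace (by simp [det_adjugate, hC])
  have hsq := trace_sq_eq (Cᵀ * C)
  have hs : (Cᵀ * C).IsSymm := by simp [IsSymm]
  have e : matDist (Cᵀ * C) 1 ^ 2
      = (Cᵀ * C * (Cᵀ * C)).trace - 2 * (Cᵀ * C).trace + 3 := by
    rw [matDist, Real.sq_sqrt (Finset.sum_nonneg fun i _ => Finset.sum_nonneg fun j _ => sq_nonneg _)]
    generalize Cᵀ * C = g at hs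
    have h01 := hs.apply 0 1
    have h02 := hs.apply 0 2
    have h12 := hs.apply 1 2
    simp [trace_fin_three, mul_apply, Fin.sum_univ_three, h01, h02, h12]
    ring
  nlinarith

theorem abs_sub_le_matDist (g h : Mat3) (i j : Fin 3) : |g i j - h i j| ≤ matDist g h := by
  apply Real.abs_le_sqrt
  refine le_trans ?_ (Finset.single_le_sum (f := fun i => ∑ j, (g i j - h i j) ^ 2)
    (fun i _ => Finset.sum_nonneg fun j _ => sq_nonneg _) (Finset.mem_univ i))
  exact Finset.single_le_sum (f := fun j => (g i j - h i j) ^ 2)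
    (fun j _ => sq_nonneg _) (Finset.mem_univ j)

theorem trace_sub_three_le (g : Mat3) : g.trace - 3 ≤ 3 * matDist g 1 := by
  have h := fun i => (le_abs_self _).trans (abs_sub_le_matDist g 1 i i)
  simp only [one_apply_eq] at h
  rw [trace_fin_three]
  linarith [h 0, h 1, h 2]

end Algebra

/-- The vector field of the flow on unimodular coframes `C = A⁻¹`. -/
noncomputable def coframeField (C : Mat3) : Mat3 := (-(1 / 16) : ℝ) • (C * flowPoly (Cᵀ * C))

/-! ### Conservation and decay along the coframe equation. -/

section Dynamics

variable {C : ℝ → Mat3} {s : Set ℝ} {t c : ℝ}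

/-- The factor `c` allows for the `(det A)²` in the flow, which is not known to be one until this
lemma has been applied. -/
theorem hasDerivWithinAt_det_of_coframeField
    (hC : HasDerivWithinAt C (c • coframeField (C t)) s t) :
    HasDerivWithinAt (fun x => (C x).det) 0 s t := by
  refine (hasDerivWithinAt_matrix_det hC).congr_deriv ?_
  rw [coframeField, Matrix.mul_smul, Matrix.mul_smul, ← Matrix.mul_assoc, adjugate_mul,
    Matrix.smul_mul, Matrix.one_mul]
  simp [trace_smul, trace_flowPoly]

theorem transpose_coframeField_mul_add (C : Mat3) :
    (coframeField C)ᵀ * C + Cᵀ * coframeField C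
      = (-(1 / 8) : ℝ) • (Cᵀ * C * flowPoly (Cᵀ * C)) := by
  have h : (Cᵀ * C * flowPoly (Cᵀ * C))ᵀ = Cᵀ * C * flowPoly (Cᵀ * C) := by
    have hs : (Cᵀ * C)ᵀ = Cᵀ * C := by simp
    generalize Cᵀ * C = g at hs
    simp only [flowPoly, Matrix.mul_sub, transpose_sub, transpose_mul, transpose_smul,
      Matrix.mul_smul, Matrix.mul_one, hs, Matrix.mul_assoc]
  have h2 : (coframeField C)ᵀ * C = (Cᵀ * coframeField C)ᵀ := by
    rw [transpose_mul, transpose_transpose]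
  have h3 : Cᵀ * coframeField C = (-(1 / 16) : ℝ) • (Cᵀ * C * flowPoly (Cᵀ * C)) := by
    rw [coframeField, Matrix.mul_smul, Matrix.mul_assoc]
  rw [h2, h3, transpose_smul, h]
  module

theorem hasDerivWithinAt_gram (hC : HasDerivWithinAt C (coframeField (C t)) s t) :
    HasDerivWithinAt (fun x => (C x)ᵀ * C x)
      ((-(1 / 8) : ℝ) • ((C t)ᵀ * C t * flowPoly ((C t)ᵀ * C t))) s t := by
  rw [← transpose_coframeField_mul_add]
  exact hasDerivWithinAt_matrix_mul (hasDerivWithinAt_matrix_transpose hC) hC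

theorem hasDerivWithinAt_trace_gram (hC : HasDerivWithinAt C (coframeField (C t)) s t) :
    HasDerivWithinAt (fun x => ((C x)ᵀ * C x).trace)
      (-(1 / 8) * ((C t)ᵀ * C t * flowPoly ((C t)ᵀ * C t)).trace) s t := by
  simpa [trace_smul] using hasDerivWithinAt_matrix_trace (hasDerivWithinAt_gram hC)

/-- A Grönwall argument; the rate is `3/40 = (1/8)(3/5)`. -/
theorem trace_gram_sub_three_le (hC : ∀ t ∈ Set.Ici (0 : ℝ),
      HasDerivWithinAt C (coframeField (C t)) (Set.Ici 0) t)
    (hdet : ∀ t ∈ Set.Ici (0 : ℝ), (C t).det = 1) {t : ℝ} (ht : 0 ≤ t) :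
    ((C t)ᵀ * C t).trace - 3 ≤ (((C 0)ᵀ * C 0).trace - 3) * Real.exp (-(3 / 40) * t) := by
  have hd : ∀ t ∈ Set.Ici (0 : ℝ), HasDerivWithinAt
      (fun x => (((C x)ᵀ * C x).trace - 3) * Real.exp ((3 / 40) * x))
      (-(1 / 8) * ((C t)ᵀ * C t * flowPoly ((C t)ᵀ * C t)).trace * Real.exp ((3 / 40) * t)
        + (((C t)ᵀ * C t).trace - 3) * (Real.exp ((3 / 40) * t) * ((3 / 40) * 1)))
      (Set.Ici 0) t := fun t ht =>
    ((hasDerivWithinAt_trace_gram (hC t ht)).sub_const 3).fun_mul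
      ((hasDerivWithinAt_id t _).const_mul (3 / 40)).exp
  have hanti : AntitoneOn (fun x => (((C x)ᵀ * C x).trace - 3) * Real.exp ((3 / 40) * x))
      (Set.Ici 0) := by
    refine antitoneOn_of_hasDerivWithinAt_nonpos (convex_Ici 0)
      (fun t ht => (hd t ht).continuousWithinAt)
      (fun t ht => (hd t (interior_subset ht)).mono interior_subset) fun t ht => ?_
    have h := trace_mul_flowPoly_ge_of_det (hdet t (interior_subset ht))
    have he := (Real.exp_pos ((3 / 40) * t)).le
    nlinarith
  have h := hanti Set.self_mem_Ici ht ht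
  simp only [mul_zero, Real.exp_zero, mul_one] at h
  calc ((C t)ᵀ * C t).trace - 3
      = (((C t)ᵀ * C t).trace - 3) * Real.exp ((3 / 40) * t) * Real.exp (-(3 / 40) * t) := by
        rw [mul_assoc, ← Real.exp_add]; simp
    _ ≤ _ := mul_le_mul_of_nonneg_right h (Real.exp_pos _).le

end Dynamics

/-! ### Existence and uniqueness for the coframe equation. -/

section Existence

theorem contDiff_matrix_mul {E : Type*} [NormedAddCommGroup E] [NormedSpace ℝ E] {F G : E → Mat3}
    (hF : ∀ i j, ContDiff ℝ 1 fun x => F x i j) (hG : ∀ i j, ContDiff ℝ 1 fun x => G x i j)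
    (i j : Fin 3) : ContDiff ℝ 1 fun x => (F x * G x) i j := by
  simp only [mul_apply]
  exact ContDiff.sum fun k _ => (hF i k).mul (hG k j)

theorem contDiff_coframeField :
    ContDiff ℝ 1 (fun (C : Fin 3 → Fin 3 → ℝ) i j => coframeField (of C) i j) := by
  have hid : ∀ i j, ContDiff ℝ 1 fun C : Fin 3 → Fin 3 → ℝ => (of C) i j := fun i j =>
    contDiff_apply_apply ℝ ℝ i j
  have hg : ∀ i j, ContDiff ℝ 1 fun C : Fin 3 → Fin 3 → ℝ => ((of C)ᵀ * of C) i j :=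
    contDiff_matrix_mul (E := Fin 3 → Fin 3 → ℝ) (F := fun C => (of C)ᵀ) (G := fun C => of C)
      (fun i j => hid j i) hid
  have hgg := contDiff_matrix_mul (E := Fin 3 → Fin 3 → ℝ) (F := fun C => (of C)ᵀ * of C)
    (G := fun C => (of C)ᵀ * of C) hg hg
  have htr : ContDiff ℝ 1 fun C : Fin 3 → Fin 3 → ℝ => ((of C)ᵀ * of C).trace :=
    ContDiff.sum fun i _ => hg i i
  have htr2 : ContDiff ℝ 1 fun C : Fin 3 → Fin 3 → ℝ =>
      ((of C)ᵀ * of C * ((of C)ᵀ * of C)).trace := ContDiff.sum fun i _ => hgg i i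
  have hP : ∀ i j, ContDiff ℝ 1 fun C : Fin 3 → Fin 3 → ℝ =>
      flowPoly ((of C)ᵀ * of C) i j := by
    intro i j
    simp only [flowPoly, energyPoly, Matrix.sub_apply, Matrix.smul_apply, smul_eq_mul]
    exact ((contDiff_const.mul (hgg i j)).sub ((contDiff_const.mul htr).mul (hg i j))).sub
      ((contDiff_const.mul (htr2.sub (contDiff_const.mul (htr.pow 2)))).mul contDiff_const)
  have hf := contDiff_matrix_mul (E := Fin 3 → Fin 3 → ℝ) (F := fun C => of C)
    (G := fun C => flowPoly ((of C)ᵀ * of C)) hid hP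
  refine contDiff_pi' fun i => contDiff_pi' fun j => ?_
  simp only [coframeField, Matrix.smul_apply, smul_eq_mul]
  exact contDiff_const.mul (hf i j)

theorem exists_coframe_solution (C₀ : Mat3) :
    ∃ C : ℝ → Mat3, C 0 = C₀ ∧ ∀ t ∈ Set.Ici (0 : ℝ),
      HasDerivWithinAt C (coframeField (C t)) (Set.Ici 0) t := by
  have hq : Differentiable ℝ fun C : Fin 3 → Fin 3 → ℝ => ((of C)ᵀ * of C).trace := by
    simp only [trace, diag_apply, mul_apply, transpose_apply, of_apply]
    fun_prop
  have hqf : ∀ C : Fin 3 → Fin 3 → ℝ, fderiv ℝ (fun C : Fin 3 → Fin 3 → ℝ =>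
      ((of C)ᵀ * of C).trace) C (fun i j => coframeField (of C) i j) ≤ 0 := by
    intro C
    -- The line through `C` in the direction of the field has the right velocity at `s = 0`, so the
    -- trace derivative already computed along curves gives the value of `fderiv`.
    let γ : ℝ → Fin 3 → Fin 3 → ℝ := fun s i j => C i j + s * coframeField C i j
    have hγ0 : γ 0 = C := by simp [γ]
    have hγ : HasDerivAt γ (coframeField C : Fin 3 → Fin 3 → ℝ) 0 := by
      refine hasDerivAt_pi.2 fun i => hasDerivAt_pi.2 fun j => ?_
      refine (((hasDerivAt_id (0 : ℝ)).mul_const (coframeField C i j)).const_add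
        (C i j)).congr_deriv ?_
      simp
    have h1 : HasDerivAt (fun s => ((of (γ s))ᵀ * of (γ s)).trace) _ 0 :=
      (hq (γ 0)).hasFDerivAt.comp_hasDerivAt 0 hγ
    have h2 : HasDerivWithinAt (fun s => of (γ s)) (coframeField (of (γ 0))) Set.univ 0 := by
      rw [hγ0]
      exact hasDerivWithinAt_matrix_iff.2 fun i j =>
        (hasDerivAt_pi.1 (hasDerivAt_pi.1 hγ i) j).hasDerivWithinAt
    have h3 := h1.unique (hasDerivWithinAt_univ.1 (hasDerivWithinAt_trace_gram h2))
    rw [hγ0] at h3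
    refine h3.le.trans ?_
    have := trace_mul_flowPoly_nonneg (of C) rfl
    linarith
  have hbdd : ∀ c, ∃ r, ∀ C : Fin 3 → Fin 3 → ℝ, ((of C)ᵀ * of C).trace ≤ c → ‖C‖ ≤ r := by
    refine fun c => ⟨√c, fun C hC => ?_⟩
    refine (pi_norm_le_iff_of_nonneg (Real.sqrt_nonneg c)).2 fun i =>
      (pi_norm_le_iff_of_nonneg (Real.sqrt_nonneg c)).2 fun j => Real.abs_le_sqrt (le_trans ?_ hC)
    simp only [trace, diag_apply, mul_apply, transpose_apply, of_apply, ← sq]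
    exact (Finset.single_le_sum (f := fun i => C i j ^ 2) (fun i _ => sq_nonneg _)
      (Finset.mem_univ i)).trans (Finset.single_le_sum (f := fun j => ∑ i, C i j ^ 2)
      (fun j _ => Finset.sum_nonneg fun i _ => sq_nonneg _) (Finset.mem_univ j))
  obtain ⟨α, h0, hα⟩ := exists_forall_hasDerivAt_of_lyapunov contDiff_coframeField hq hqf hbdd C₀
  refine ⟨α, h0, fun t ht => hasDerivWithinAt_matrix_iff.2 fun i j => ?_⟩
  exact (hasDerivAt_pi.1 (hasDerivAt_pi.1 (hα t ht) i) j).hasDerivWithinAt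

theorem coframe_solution_unique {T : ℝ} {C D : ℝ → Mat3}
    (hC : ∀ t ∈ Set.Ico 0 T, HasDerivWithinAt C (coframeField (C t)) (Set.Ico 0 T) t)
    (hD : ∀ t ∈ Set.Ico 0 T, HasDerivWithinAt D (coframeField (D t)) (Set.Ico 0 T) t)
    (h0 : C 0 = D 0) : Set.EqOn C D (Set.Ico 0 T) := by
  have conv : ∀ {F : ℝ → Mat3}, (∀ t ∈ Set.Ico 0 T,
      HasDerivWithinAt F (coframeField (F t)) (Set.Ico 0 T) t) → ∀ t ∈ Set.Ico 0 T,
      HasDerivWithinAt (F : ℝ → Fin 3 → Fin 3 → ℝ) (coframeField (F t) : Fin 3 → Fin 3 → ℝ)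
        (Set.Ico 0 T) t := fun hF t ht => hasDerivWithinAt_pi.2 fun i => hasDerivWithinAt_pi.2
      fun j => hasDerivWithinAt_matrix_iff.1 (hF t ht) i j
  exact eqOn_Ico_of_hasDerivWithinAt contDiff_coframeField (conv hC) (conv hD) h0

end Existence

end SpinorFlow

/-! ### Diagonal metrics and the linearization. -/

namespace SpinorFlow

theorem det_metricOf (A : Mat3) : (metricOf A).det = (A.det ^ 2)⁻¹ := by
  rw [metricOf, det_mul, det_transpose, det_nonsing_inv, Ring.inverse_eq_inv', sq, mul_inv]

theorem det_eq_one_of_det_metricOf {A : Mat3} (hA : 0 < A.det) (h : (metricOf A).det = 1) :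
    A.det = 1 := by
  rw [det_metricOf, inv_eq_one] at h
  exact (pow_eq_one_iff_of_nonneg hA.le two_ne_zero).1 h

/-- The right-hand side of the flow on diagonal metrics. -/
noncomputable def diagField (a : Fin 3 → ℝ) (i : Fin 3) : ℝ :=
  -(1 / 8) * (a 0 * a 1 * a 2)⁻¹ * (a i * (2 * (a i * a i) - (1 / 2) * (a 0 + a 1 + a 2) * a i
    - (2 / 3) * (a 0 * a 0 + a 1 * a 1 + a 2 * a 2 - (1 / 4) * (a 0 + a 1 + a 2) ^ 2)))

theorem metricVelocity_of_diagonal {A : Mat3} {a : Fin 3 → ℝ} (h : metricOf A = diagonal a) :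
    metricVelocity A = diagonal (diagField a) := by
  -- Only `(det A)² = 1 / det g` enters, so the velocity does not depend on the choice of `A` over
  -- `g`.
  have hdet : A.det ^ 2 = (a 0 * a 1 * a 2)⁻¹ := by
    rw [← inv_inv (A.det ^ 2), ← det_metricOf, h, det_diagonal, Fin.prod_univ_three]
  rw [metricVelocity, h, hdet]
  ext i j
  by_cases hij : i = j
  · subst hij
    simp [flowPoly, energyPoly, diagField, Fin.sum_univ_three]
  · simp [flowPoly, hij]

theorem hasFDerivAt_diagField :
    HasFDerivAt diagField (LinearMap.toContinuousLinearMap (Matrix.toLin' linMatrix))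
      (fun _ => 1) := by
  rw [hasFDerivAt_pi']
  intro i
  have hp : ∀ j : Fin 3, HasFDerivAt (fun a : Fin 3 → ℝ => a j)
      (ContinuousLinearMap.proj (R := ℝ) (φ := fun _ : Fin 3 => ℝ) j) (fun _ => (1 : ℝ)) :=
    fun j => hasFDerivAt_apply j _
  have hs := ((hp 0).fun_add (hp 1)).fun_add (hp 2)
  have hF := ((((hp 0).fun_mul (hp 0)).fun_add ((hp 1).fun_mul (hp 1))).fun_add
    ((hp 2).fun_mul (hp 2))).fun_sub ((hs.pow 2).const_mul (1 / 4))
  have hinv : HasFDerivAt (fun a : Fin 3 → ℝ => (a 0 * a 1 * a 2)⁻¹) _ (fun _ => (1 : ℝ)) :=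
    (hasDerivAt_inv (x := (1 : ℝ) * 1 * 1) (by norm_num)).comp_hasFDerivAt
      (fun _ : Fin 3 => (1 : ℝ)) (((hp 0).fun_mul (hp 1)).fun_mul (hp 2))
  have h := (hinv.const_mul (-(1 / 8))).fun_mul ((hp i).fun_mul
    (((((hp i).fun_mul (hp i)).const_mul 2).fun_sub ((hs.const_mul (1 / 2)).fun_mul (hp i))).fun_sub
      (hF.const_mul (2 / 3))))
  refine h.congr_fderiv ?_
  ext v
  simp [linMatrix, dotProduct, Fin.sum_univ_three]
  fin_cases i <;>
  · simp
    ring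

/-! ### Spectrum of the linearization. -/

section Spectrum

/-- The matrix is `-(5/16) I + (5/48) J` with `J` the all-ones matrix, from which all eigenspaces
can be read off. -/
theorem linMatrix_mulVec (v : Fin 3 → ℝ) (i : Fin 3) :
    (linMatrix *ᵥ v) i = -(5 / 16) * v i + (5 / 48) * ∑ j, v j := by
  fin_cases i <;>
  · simp [linMatrix, mulVec, dotProduct, Fin.sum_univ_three]
    ring

theorem mem_eigenspace_linMatrix_iff {c : ℝ} {v : Fin 3 → ℝ} :
    v ∈ Module.End.eigenspace (Matrix.toLin' linMatrix) c ↔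
      ∀ i, -(5 / 16) * v i + (5 / 48) * ∑ j, v j = c * v i := by
  rw [Module.End.mem_eigenspace_iff, toLin'_apply, funext_iff]
  simp only [linMatrix_mulVec, Pi.smul_apply, smul_eq_mul]

theorem eigenspace_linMatrix_zero :
    Module.End.eigenspace (Matrix.toLin' linMatrix) 0 = Submodule.span ℝ {fun _ => 1} := by
  ext v
  rw [mem_eigenspace_linMatrix_iff, Submodule.mem_span_singleton]
  constructor
  · intro h
    refine ⟨(∑ j, v j) / 3, funext fun i => ?_⟩
    have := h i
    simp only [Pi.smul_apply, smul_eq_mul]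
    linarith
  · rintro ⟨a, rfl⟩ i
    simp
    ring

theorem mem_eigenspace_linMatrix_iff_sum (v : Fin 3 → ℝ) :
    v ∈ Module.End.eigenspace (Matrix.toLin' linMatrix) (-(5 / 16)) ↔ ∑ i, v i = 0 := by
  rw [mem_eigenspace_linMatrix_iff]
  constructor
  · intro h
    linarith [h 0]
  · intro h i
    rw [h]
    ring

theorem hasEigenvalue_linMatrix_iff (c : ℝ) :
    Module.End.HasEigenvalue (Matrix.toLin' linMatrix) c ↔ c = 0 ∨ c = -(5 / 16) := by
  rw [Module.End.hasEigenvalue_iff, Submodule.ne_bot_iff]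
  constructor
  · rintro ⟨v, hv, hv0⟩
    rw [mem_eigenspace_linMatrix_iff] at hv
    by_cases hs : ∑ j, v j = 0
    · right
      obtain ⟨i, hi⟩ := Function.ne_iff.1 hv0
      have := hv i
      rw [hs] at this
      have h2 : (c + 5 / 16) * v i = 0 := by linarith
      rcases mul_eq_zero.1 h2 with h | h
      · linarith
      · exact absurd h hi
    · left
      have h0 := hv 0
      have h1 := hv 1
      have h2 := hv 2
      rw [Fin.sum_univ_three] at *
      -- Adding the three rows cancels the left-hand sides, since the columns of `linMatrix` sum to
      -- zero.
      have h3 : c * (v 0 + v 1 + v 2) = 0 := by linarith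
      exact (mul_eq_zero.1 h3).resolve_right hs
  · rintro (rfl | rfl)
    · refine ⟨fun _ => 1, ?_, fun h => one_ne_zero (congrFun h 0)⟩
      rw [eigenspace_linMatrix_zero]
      exact Submodule.mem_span_singleton_self _
    · refine ⟨![1, -1, 0], ?_, fun h => one_ne_zero (congrFun h 0)⟩
      rw [mem_eigenspace_linMatrix_iff_sum]
      simp [Fin.sum_univ_three]

theorem finrank_eigenspace_linMatrix :
    Module.finrank ℝ (Module.End.eigenspace (Matrix.toLin' linMatrix) (-(5 / 16))) = 2 := by
  let σ : (Fin 3 → ℝ) →ₗ[ℝ] ℝ := ∑ i, LinearMap.proj i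
  have hσ : Module.End.eigenspace (Matrix.toLin' linMatrix) (-(5 / 16)) = LinearMap.ker σ := by
    ext v
    rw [mem_eigenspace_linMatrix_iff_sum, LinearMap.mem_ker]
    simp [σ]
  have hsurj : LinearMap.range σ = ⊤ := LinearMap.range_eq_top.2 fun x =>
    ⟨Pi.single 0 x, by simp [σ, Fin.sum_univ_three]⟩
  have h := LinearMap.finrank_range_add_finrank_ker σ
  rw [hsurj, finrank_top, Module.finrank_self, Module.finrank_fin_fun] at h
  rw [hσ]
  omega

end Spectrum

/-! ### From the coframe equation back to the spinor flow. -/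

section Flow

variable {𝔤 : Type*} [LieRing 𝔤] [LieAlgebra ℝ 𝔤] {X : Module.Basis (Fin 3) ℝ 𝔤}

/-- A horizontal vector over a metric variation `-⅛ det(A)² g P(g)` has prescribed coframe
velocity. -/
theorem coframe_velocity_eq {A A' : Mat3} (hA : A.det ≠ 0) (hh : IsHorizontal A A')
    (h : metricVariation A A' = metricVelocity A) :
    -(A⁻¹ * A' * A⁻¹) = A.det ^ 2 • coframeField A⁻¹ := by
  have h1 : A⁻¹ * A = 1 := nonsing_inv_mul _ hA.isUnit
  have h2 : A * A⁻¹ = 1 := mul_nonsing_inv _ hA.isUnit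
  have h1t : Aᵀ * (A⁻¹)ᵀ = 1 := by rw [← transpose_mul, h1, transpose_one]
  have hK : (A⁻¹ * A')ᵀ = A⁻¹ * A' := hh
  have e : metricOf A * A' * A⁻¹ = (A⁻¹)ᵀ * (A⁻¹ * A') * A⁻¹ := by
    rw [metricOf]; simp only [Matrix.mul_assoc]
  have e2 : metricVariation A A' = (-2 : ℝ) • ((A⁻¹)ᵀ * ((A⁻¹ * A') * A⁻¹)) := by
    rw [metricVariation, e, transpose_mul, transpose_mul, transpose_transpose, hK,
      ← Matrix.mul_assoc]
    module
  have e3 : A⁻¹ * A' * A⁻¹ = (-(1 / 2) : ℝ) • (Aᵀ * metricVariation A A') := by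
    rw [e2, Matrix.mul_smul, ← Matrix.mul_assoc Aᵀ, h1t, Matrix.one_mul]
    module
  have e4 : Aᵀ * metricVelocity A
      = (-(1 / 8) * A.det ^ 2) • (A⁻¹ * flowPoly ((A⁻¹)ᵀ * A⁻¹)) := by
    rw [metricVelocity, metricOf, Matrix.mul_smul, ← Matrix.mul_assoc Aᵀ, ← Matrix.mul_assoc Aᵀ,
      h1t, Matrix.one_mul]
  rw [e3, h, e4, coframeField]
  module

/-- Uniqueness of the gradient and of horizontal lifts reduces any solution to the coframe ODE, up
to the factor `(det A)²`. The determinant is then constant, which removes the factor. -/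
theorem IsNormalizedFlow.coframe (hX : IsStandardBasis X) {I : Set ℝ} {A : ℝ → Mat3}
    {φ : ℝ → Spinor} (hI : Convex ℝ I) (hI' : UniqueDiffOn ℝ I) (h : IsNormalizedFlow X I A φ)
    {t₀ : ℝ} (ht₀ : t₀ ∈ I) (hdet : (A t₀).det = 1) :
    ∀ t ∈ I, (A t)⁻¹.det = 1 ∧ φ t = φ t₀ ∧
      HasDerivWithinAt (fun s => (A s)⁻¹) (coframeField (A t)⁻¹) I t := by
  have key : ∀ t ∈ I, HasDerivWithinAt φ 0 I t ∧
      HasDerivWithinAt (fun s => (A s)⁻¹) ((A t).det ^ 2 • coframeField (A t)⁻¹) I t := by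
    intro t ht
    obtain ⟨hpos, hφ, ⟨A', hA', hhor⟩, q₁, q₂, hq, hg, hψ⟩ := h t ht
    obtain ⟨rfl, rfl⟩ := hX.eq_of_isNormalizedVelocity hpos.ne' hφ hq
    have hv : metricVariation (A t) A' = metricVelocity (A t) := by
      ext i j
      exact (hI' t ht).eq_deriv _
        (hasDerivWithinAt_matrix_iff.1 (hasDerivWithinAt_metricOf hA' hpos.ne') i j)
        (hasDerivWithinAt_matrix_iff.1 hg i j)
    refine ⟨hψ, ?_⟩
    rw [← coframe_velocity_eq hpos.ne' hhor hv]
    exact hasDerivWithinAt_matrix_inv hA' hpos.ne'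
  have hdet1 : ∀ t ∈ I, (A t)⁻¹.det = 1 := by
    intro t ht
    rw [hI.eq_of_hasDerivWithinAt_zero (u := fun s => (A s)⁻¹.det)
      (fun t ht => hasDerivWithinAt_det_of_coframeField (key t ht).2) ht₀ ht,
      det_nonsing_inv, hdet, Ring.inverse_one]
  refine fun t ht => ⟨hdet1 t ht, hI.eq_of_hasDerivWithinAt_zero (fun t ht => (key t ht).1) ht₀ ht,
    ?_⟩
  have h1 : (A t).det = 1 := by
    have := hdet1 t ht
    rwa [det_nonsing_inv, Ring.inverse_eq_inv', inv_eq_one] at this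
  simpa [h1] using (key t ht).2

theorem matDist_sq_le_of_trace_le {C : Mat3} (hC : C.det = 1) {d : ℝ}
    (h : (Cᵀ * C).trace - 3 ≤ d) : matDist (Cᵀ * C) 1 ^ 2 ≤ d * (d + 4) := by
  refine (matDist_sq_le hC).trans ?_
  have := three_le_trace hC
  exact mul_le_mul h (by linarith) (by linarith) (by linarith)

/-- Moving `C` through the polynomial, `C p(CᵀC) = p(CCᵀ) C`, shows that `A⁻¹A'` is a polynomial in
the symmetric matrix `CCᵀ`. -/
theorem isHorizontal_of_coframe {C : Mat3} (hC : C.det ≠ 0) :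
    IsHorizontal C⁻¹ (-(C⁻¹ * coframeField C * C⁻¹)) := by
  have h1 : C⁻¹ * C = 1 := nonsing_inv_mul _ hC.isUnit
  have h2 : C * C⁻¹ = 1 := mul_nonsing_inv _ hC.isUnit
  have e : C * flowPoly (Cᵀ * C) = ((2 : ℝ) • (C * Cᵀ * (C * Cᵀ))
      - ((1 / 2) * (Cᵀ * C).trace) • (C * Cᵀ) - ((2 / 3) * energyPoly (Cᵀ * C)) • 1) * C := by
    simp only [flowPoly, Matrix.mul_sub, Matrix.sub_mul, Matrix.mul_smul, Matrix.smul_mul,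
      Matrix.mul_one, Matrix.one_mul, Matrix.mul_assoc]
  have e2 : (C⁻¹)⁻¹ * -(C⁻¹ * coframeField C * C⁻¹) = ((1 / 16 : ℝ)) •
      ((2 : ℝ) • (C * Cᵀ * (C * Cᵀ)) - ((1 / 2) * (Cᵀ * C).trace) • (C * Cᵀ)
        - ((2 / 3) * energyPoly (Cᵀ * C)) • (1 : Mat3)) := by
    rw [nonsing_inv_nonsing_inv _ hC.isUnit, Matrix.mul_neg, ← Matrix.mul_assoc, ← Matrix.mul_assoc,
      h2, Matrix.one_mul, coframeField, e, Matrix.smul_mul, Matrix.mul_assoc, h2, Matrix.mul_one]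
    module
  rw [IsHorizontal, e2, IsSymm]
  simp only [transpose_smul, transpose_sub, transpose_mul, transpose_transpose, transpose_one]

theorem exists_normalizedFlow (hX : IsStandardBasis X) {A₀ : Mat3} {φ₀ : Spinor}
    (hA : A₀.det = 1) (hφ : ‖φ₀‖ = 1) :
    ∃ A : ℝ → Mat3, A 0 = A₀ ∧ IsNormalizedFlow X (Set.Ici 0) A (fun _ => φ₀) := by
  obtain ⟨C, hC0, hC⟩ := exists_coframe_solution A₀⁻¹
  have hdet : ∀ t ∈ Set.Ici (0 : ℝ), (C t).det = 1 := by
    intro t ht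
    rw [(convex_Ici 0).eq_of_hasDerivWithinAt_zero (u := fun s => (C s).det)
      (fun t ht => hasDerivWithinAt_det_of_coframeField (c := 1) (by simpa using hC t ht))
      Set.self_mem_Ici ht, hC0, det_nonsing_inv, hA, Ring.inverse_one]
  refine ⟨fun t => (C t)⁻¹, ?_, fun t ht => ?_⟩
  · simp only [hC0]
    exact nonsing_inv_nonsing_inv _ (by simp [hA])
  have hd := hdet t ht
  have hne : (C t).det ≠ 0 := by simp [hd]
  have hdi : (C t)⁻¹.det = 1 := by rw [det_nonsing_inv, hd, Ring.inverse_one]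
  have hm : ∀ s ∈ Set.Ici (0 : ℝ), metricOf (C s)⁻¹ = (C s)ᵀ * C s := by
    intro s hs
    rw [metricOf, nonsing_inv_nonsing_inv _ (by simp [hdet s hs])]
  refine ⟨by simp [hdi], hφ, ⟨_, hasDerivWithinAt_matrix_inv (hC t ht) hne,
    isHorizontal_of_coframe hne⟩, _, _, hX.isNormalizedVelocity (by simp [hdi]) hφ, ?_,
    hasDerivWithinAt_const _ _ _⟩
  have h := hasDerivWithinAt_gram (hC t ht)
  have e : metricVelocity (C t)⁻¹
      = (-(1 / 8) : ℝ) • ((C t)ᵀ * C t * flowPoly ((C t)ᵀ * C t)) := by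
    rw [metricVelocity, hm t ht, hdi]
    norm_num
  rw [e]
  rw [hasDerivWithinAt_matrix_iff] at h ⊢
  intro i j
  exact (h i j).congr_of_mem (fun s hs => by rw [hm s hs]) ht

theorem IsNormalizedFlow.trace_metricOf_le (hX : IsStandardBasis X) {A : ℝ → Mat3}
    {φ : ℝ → Spinor} (h : IsNormalizedFlow X (Set.Ici 0) A φ) (hdet : (A 0).det = 1) {t : ℝ}
    (ht : 0 ≤ t) :
    (metricOf (A t)).trace - 3 ≤ ((metricOf (A 0)).trace - 3) * Real.exp (-(3 / 40) * t) := by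
  have hc := h.coframe hX (convex_Ici 0) (uniqueDiffOn_Ici 0) Set.self_mem_Ici hdet
  exact trace_gram_sub_three_le (C := fun s => (A s)⁻¹) (fun t ht => (hc t ht).2.2)
    (fun t ht => (hc t ht).1) ht

theorem IsNormalizedFlow.tendsto_metricOf (hX : IsStandardBasis X) {A : ℝ → Mat3}
    {φ : ℝ → Spinor} (h : IsNormalizedFlow X (Set.Ici 0) A φ) (hdet : (A 0).det = 1) :
    Tendsto (fun t => metricOf (A t)) atTop (𝓝 1) := by
  have hc := h.coframe hX (convex_Ici 0) (uniqueDiffOn_Ici 0) Set.self_mem_Ici hdet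
  set c := (metricOf (A 0)).trace - 3
  have hexp : Tendsto (fun t : ℝ => c * Real.exp (-(3 / 40) * t)) atTop (𝓝 0) := by
    have h1 : Tendsto (fun t : ℝ => -(3 / 40) * t) atTop atBot :=
      tendsto_id.const_mul_atTop_of_neg (by norm_num)
    simpa using (Real.tendsto_exp_atBot.comp h1).const_mul c
  have hb : Tendsto (fun t : ℝ => √((c * Real.exp (-(3 / 40) * t)) *
      (c * Real.exp (-(3 / 40) * t) + 4))) atTop (𝓝 0) := by
    have := (hexp.mul (hexp.add_const 4)).sqrt
    simpa using this
  refine tendsto_pi_nhds.2 fun i => tendsto_pi_nhds.2 fun j => ?_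
  rw [tendsto_iff_dist_tendsto_zero]
  refine squeeze_zero' (Eventually.of_forall fun _ => dist_nonneg) ?_ hb
  filter_upwards [eventually_ge_atTop 0] with t ht
  rw [Real.dist_eq]
  refine (abs_sub_le_matDist _ _ i j).trans (Real.le_sqrt_of_sq_le ?_)
  exact matDist_sq_le_of_trace_le (hc t ht).1 (h.trace_metricOf_le hX hdet ht)

theorem IsNormalizedFlow.eqOn_Ico (hX : IsStandardBasis X) {A B : ℝ → Mat3} {φ ψ : ℝ → Spinor}
    {T : ℝ} (hA : IsNormalizedFlow X (Set.Ico 0 T) A φ) (hB : IsNormalizedFlow X (Set.Ico 0 T) B ψ)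
    (h0 : B 0 = A 0) (h0' : ψ 0 = φ 0) (hdet : (A 0).det = 1) {t : ℝ} (ht : t ∈ Set.Ico 0 T) :
    B t = A t ∧ ψ t = φ t := by
  have hm : (0 : ℝ) ∈ Set.Ico 0 T := ⟨le_rfl, ht.1.trans_lt ht.2⟩
  have hcA := hA.coframe hX (convex_Ico 0 T) (uniqueDiffOn_Ico 0 T) hm hdet
  have hcB := hB.coframe hX (convex_Ico 0 T) (uniqueDiffOn_Ico 0 T) hm (by rw [h0, hdet])
  have h := coframe_solution_unique (C := fun s => (B s)⁻¹) (D := fun s => (A s)⁻¹)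
    (fun t ht => (hcB t ht).2.2) (fun t ht => (hcA t ht).2.2) (by simp only [h0]) ht
  refine ⟨?_, by rw [(hcB t ht).2.1, (hcA t ht).2.1, h0']⟩
  rw [← nonsing_inv_nonsing_inv (B t) (hB t ht).1.ne'.isUnit,
    ← nonsing_inv_nonsing_inv (A t) (hA t ht).1.ne'.isUnit]
  exact congrArg _ h

theorem IsNormalizedFlow.mono {I J : Set ℝ} {A : ℝ → Mat3} {φ : ℝ → Spinor}
    (h : IsNormalizedFlow X I A φ) (hJ : J ⊆ I) : IsNormalizedFlow X J A φ := by
  intro t ht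
  obtain ⟨hpos, hφ, ⟨A', hA', hhor⟩, q₁, q₂, hq, hg, hψ⟩ := h t (hJ ht)
  exact ⟨hpos, hφ, ⟨A', hasDerivWithinAt_matrix_mono hA' hJ, hhor⟩, q₁, q₂, hq,
    hasDerivWithinAt_matrix_mono hg hJ, hψ.mono hJ⟩

theorem lyapunov_stable (hX : IsStandardBasis X) {ε : ℝ} (hε : 0 < ε) :
    ∃ δ : ℝ, 0 < δ ∧ ∀ (A : ℝ → Mat3) (φ : ℝ → Spinor),
      IsNormalizedFlow X (Set.Ici 0) A φ → (A 0).det = 1 → matDist (metricOf (A 0)) 1 < δ →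
        ∀ t, 0 ≤ t → matDist (metricOf (A t)) 1 < ε := by
  -- For initial distance `m < 1` the trace excess is at most `3m`, so the squared distance is at
  -- most `3m (3m + 4) ≤ 21m`.
  refine ⟨min 1 (ε ^ 2 / 21), by positivity, fun A φ h hdet hd t ht => ?_⟩
  have hc := h.coframe hX (convex_Ici 0) (uniqueDiffOn_Ici 0) Set.self_mem_Ici hdet
  have h3 : 3 ≤ (metricOf (A 0)).trace := three_le_trace (hc 0 Set.self_mem_Ici).1
  have hexp : Real.exp (-(3 / 40) * t) ≤ 1 := Real.exp_le_one_iff.2 (by linarith)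
  have htr := (h.trace_metricOf_le hX hdet ht).trans
    (mul_le_of_le_one_right (by linarith) hexp)
  have h0 := trace_sub_three_le (metricOf (A 0))
  have hd1 := hd.trans_le (min_le_left _ _)
  have hd2 := hd.trans_le (min_le_right _ _)
  refine lt_of_pow_lt_pow_left₀ 2 hε.le
    ((matDist_sq_le_of_trace_le (hc t ht).1 (htr.trans h0)).trans_lt ?_)
  have : 0 ≤ matDist (metricOf (A 0)) 1 := Real.sqrt_nonneg _
  nlinarith

end Flow

end SpinorFlow

theorem mainTheorem8 (X : Module.Basis (Fin 3) ℝ su2) (hX : IsStandardBasis X) :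
    -- the metric `ḡ = g_{1,1,1}` is round, and all unit left-invariant spinors are Killing for it
    (metricOf 1 = 1 ∧ IsRound X 1 ∧ ∀ φ : Spinor, ‖φ‖ = 1 → IsKillingSpinor X 1 φ) ∧
    -- the flow on diagonal metrics: vector field, equilibrium, linearization and its eigenvalues
    (∃ V : (Fin 3 → ℝ) → (Fin 3 → ℝ),
      (∀ (a : Fin 3 → ℝ), (∀ i, 0 < a i) → ∀ (A : Mat3) (φ : Spinor), 0 < A.det →
        metricOf A = diagonal a → ‖φ‖ = 1 → IsNormalizedVelocity X A φ (diagonal (V a)) 0) ∧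
      V (fun _ => 1) = 0 ∧
      HasFDerivAt V (LinearMap.toContinuousLinearMap (Matrix.toLin' linMatrix)) (fun _ => 1)) ∧
    (∀ c : ℝ, Module.End.HasEigenvalue (Matrix.toLin' linMatrix) c ↔ c = 0 ∨ c = -(5 / 16)) ∧
    Module.End.eigenspace (Matrix.toLin' linMatrix) 0 = Submodule.span ℝ {fun _ => 1} ∧
    (∀ α : Fin 3 → ℝ, α ∈ Module.End.eigenspace (Matrix.toLin' linMatrix) (-(5 / 16)) ↔
      ∑ i, α i = 0) ∧
    Module.finrank ℝ (Module.End.eigenspace (Matrix.toLin' linMatrix) (-(5 / 16))) = 2 ∧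
    -- every left-invariant metric of the volume of `ḡ` close to `ḡ` flows to `ḡ`
    (∃ R : ℝ, 0 < R ∧ ∀ g : Mat3, g.PosDef → g.det = 1 → matDist g 1 < R →
      ∀ (A₀ : Mat3) (φ₀ : Spinor), 0 < A₀.det → metricOf A₀ = g → ‖φ₀‖ = 1 →
        ∃ (A : ℝ → Mat3) (φ : ℝ → Spinor),
          A 0 = A₀ ∧ φ 0 = φ₀ ∧ IsNormalizedFlow X (Set.Ici 0) A φ ∧
          (∀ (T : ℝ) (B : ℝ → Mat3) (ψ : ℝ → Spinor), B 0 = A₀ → ψ 0 = φ₀ →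
            IsNormalizedFlow X (Set.Ico 0 T) B ψ →
              ∀ t ∈ Set.Ico 0 T, B t = A t ∧ ψ t = φ t) ∧
          (∀ t, 0 ≤ t → φ t = φ₀) ∧
          Tendsto (fun t => metricOf (A t)) atTop (𝓝 1)) ∧
    -- Lyapunov stability of `ḡ`
    (∀ ε : ℝ, 0 < ε → ∃ δ : ℝ, 0 < δ ∧ ∀ (A : ℝ → Mat3) (φ : ℝ → Spinor),
      IsNormalizedFlow X (Set.Ici 0) A φ → (A 0).det = 1 → matDist (metricOf (A 0)) 1 < δ →
        ∀ t, 0 ≤ t → matDist (metricOf (A t)) 1 < ε) := by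
  refine ⟨⟨metricOf_one, hX.isRound, fun φ hφ => hX.isKillingSpinor ?_⟩, ⟨diagField, ?_, ?_,
    hasFDerivAt_diagField⟩, hasEigenvalue_linMatrix_iff, eigenspace_linMatrix_zero,
    mem_eigenspace_linMatrix_iff_sum, finrank_eigenspace_linMatrix, ⟨1, one_pos, ?_⟩,
    fun ε hε => lyapunov_stable hX hε⟩
  · rintro rfl
    simp at hφ
  · intro a _ A φ hA hm hφ
    rw [← metricVelocity_of_diagonal hm]
    exact hX.isNormalizedVelocity hA.ne' hφ
  · ext i
    norm_num [diagField]
  -- The decay estimate is global among metrics of determinant one, so any positive radius serves;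
  -- `1` was chosen.
  · rintro g - hg - A₀ φ₀ hA₀ rfl hφ
    have hdet := det_eq_one_of_det_metricOf hA₀ hg
    obtain ⟨A, rfl, hA⟩ := exists_normalizedFlow hX hdet hφ
    exact ⟨A, fun _ => φ₀, rfl, rfl, hA, fun T B ψ h0 h0' hB t ht =>
      (hA.mono Set.Ico_subset_Ici_self).eqOn_Ico hX hB h0 h0' hdet ht, fun _ _ => rfl,
      hA.tendsto_metricOf hX hdet⟩
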